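/- Let $N\in\mathbb N$, $l>0$ real with $2l<N$, let $s>N-2l$ and $\theta=\frac{s}{2l-N+s}$ (so $\theta>1$). Let $\mathbb L^l=\mathbb L^l(\mathbb R^N)$ be the homogeneous Sobolev space, i.e. the complex Hilbert space obtained as the completion of $C_0^\infty(\mathbb R^N)$ in the norm $\|(-\Delta)^{l/2}v\|_{L_2(\mathbb R^N)}$. There is a constant $C=C(N,l,s)>0$ with the following property. Let $\mu$ be a Borel measure on $\mathbb R^N$, possibly with noncompact support, whose support is not a single point, and let $\mathcal A>0$ be such that $$\mu(B(X,r))\le \mathcal A\,r^{s}\qquad\text{for all }X\in\operatorname{supp}\mu\text{ and all }0<r\le\operatorname{diam}(\operatorname{supp}\mu)$$ (for all $r>0$ if $\operatorname{supp}\mu$ is unbounded). (a) Let $V\in L_\theta(\mu)$ be real-valued. Then there is a unique bounded operator $\mathbf S$ on $\mathbb L^l$ with $(\mathbf S v,v)_{\mathbb L^l}=\int V|v|^2\,d\mu$ for all $v\in C_0^\infty(\mathbb R^N)$ (the integral being absolutely convergent). It is self-adjoint and compact, and for all $\lambda>0$ $$n_\pm(\lambda,\mathbf S)\le C\,\mathcal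 A^{\theta-1}\int V_\pm^\theta\,d\mu\;\lambda^{-\theta},$$ where $V_\pm=\max(\pm V,0)$ and $n_\pm(\lambda,\mathbf S)$ is the number of eigenvalues of $\pm\mathbf S$ greater than $\lambda$, counted with multiplicity. (b) Let $V\in L_\theta(\mu)$ be complex-valued. Then there is again a unique bounded operator $\mathbf S$ on $\mathbb L^l$ with $(\mathbf S v,v)_{\mathbb L^l}=\int V|v|^2\,d\mu$ for all $v\in C_0^\infty(\mathbb R^N)$ (absolutely convergent). It is compact, and for all $\lambda>0$ $$n(\lambda,\mathbf S)\le C\,\mathcal A^{\theta-1}\int |V|^\theta\,d\mu\;\lambda^{-\theta},$$ where $n(\lambda,\mathbf S)$ is the number of singular numbers of $\mathbf S$ (square roots of the eigenvalues of $\mathbf S^*\mathbf S$) greater than $\lambda$, counted with multiplicity. -/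

import Mathlib

open MeasureTheory
open scoped ENNReal NNReal ComplexConjugate FourierTransform

noncomputable section

namespace BirmanSchwinger

/-- `ℝ^N` with the Euclidean norm. -/
abbrev Eucl (N : ℕ) : Type := EuclideanSpace ℝ (Fin N)

/-- The space `C_0^∞(ℝ^N)` of smooth, compactly supported, complex-valued functions. -/
def testFunctions (N : ℕ) : Submodule ℂ (Eucl N → ℂ) where
  carrier := {v | ContDiff ℝ (⊤ : ℕ∞) v ∧ HasCompactSupport v}
  add_mem' := fun ha hb => ⟨ha.1.add hb.1, ha.2.add hb.2⟩
  zero_mem' := ⟨contDiff_const, HasCompactSupport.zero⟩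
  smul_mem' := fun c _ hv => ⟨contDiff_const.smul hv.1, hv.2.smul_left (f := fun _ => c)⟩

/-- `C_0^∞(ℝ^N)`, to be equipped with the homogeneous Sobolev norm of order `l ≥ 0`. -/
def HomTest (N : ℕ) (_l : ℝ≥0) : Type := testFunctions N

variable {N : ℕ} {l : ℝ≥0}

instance : AddCommGroup (HomTest N l) := inferInstanceAs (AddCommGroup (testFunctions N))

instance : Module ℂ (HomTest N l) := inferInstanceAs (Module ℂ (testFunctions N))

/-- The function underlying a test function. -/
def HomTest.fn (v : HomTest N l) : Eucl N → ℂ := Subtype.val (p := (· ∈ testFunctions N)) v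

theorem HomTest.fn_add (v w : HomTest N l) : (v + w).fn = v.fn + w.fn := rfl

theorem HomTest.fn_smul (c : ℂ) (v : HomTest N l) : (c • v).fn = c • v.fn := rfl

theorem HomTest.contDiff (v : HomTest N l) : ContDiff ℝ (⊤ : ℕ∞) v.fn := v.2.1

theorem HomTest.hasCompactSupport (v : HomTest N l) : HasCompactSupport v.fn := v.2.2

/-- A test function regarded as a Schwartz function. -/
def HomTest.toSchwartz (v : HomTest N l) : SchwartzMap (Eucl N) ℂ :=
  v.hasCompactSupport.toSchwartzMap v.contDiff

theorem HomTest.fourier_eq (v : HomTest N l) :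
    𝓕 v.fn = ((𝓕 v.toSchwartz : SchwartzMap (Eucl N) ℂ) : Eucl N → ℂ) := rfl

theorem HomTest.integrable_fn (v : HomTest N l) : Integrable v.fn :=
  v.toSchwartz.integrable

theorem HomTest.fourier_add (v w : HomTest N l) (ξ : Eucl N) :
    𝓕 (v + w).fn ξ = 𝓕 v.fn ξ + 𝓕 w.fn ξ := by
  rw [HomTest.fn_add, Real.fourier_eq, Real.fourier_eq, Real.fourier_eq, ← integral_add]
  · simp [smul_add]
  · exact (Real.fourierIntegral_convergent_iff ξ).2 v.integrable_fn
  · exact (Real.fourierIntegral_convergent_iff ξ).2 w.integrable_fn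

theorem HomTest.fourier_smul (c : ℂ) (v : HomTest N l) (ξ : Eucl N) :
    𝓕 (c • v).fn ξ = c * 𝓕 v.fn ξ := by
  rw [HomTest.fn_smul, Real.fourier_eq, Real.fourier_eq, ← integral_const_mul]
  congr 1
  ext x
  simp only [Pi.smul_apply, smul_eq_mul, Circle.smul_def]
  ring

/-- The inner product `⟪(-Δ)^{l/2} v, (-Δ)^{l/2} w⟫_{L₂} = ∫ (2π|ξ|)^{2l} conj(v̂(ξ)) ŵ(ξ) dξ`,
where `v̂(ξ) = ∫ e^{-2πi x·ξ} v(x) dx`, so that `(-Δ)^{l/2}` is the Fourier multiplier `(2π|ξ|)^l`. -/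
def homInner (v w : HomTest N l) : ℂ :=
  ∫ ξ : Eucl N, (((2 * Real.pi * ‖ξ‖) ^ (2 * (l : ℝ)) : ℝ) : ℂ) * (conj (𝓕 v.fn ξ) * 𝓕 w.fn ξ)

theorem homInner_integrable (v w : HomTest N l) :
    Integrable (fun ξ : Eucl N =>
      (((2 * Real.pi * ‖ξ‖) ^ (2 * (l : ℝ)) : ℝ) : ℂ) * (conj (𝓕 v.fn ξ) * 𝓕 w.fn ξ)) := by
  rw [HomTest.fourier_eq, HomTest.fourier_eq]
  obtain ⟨k, hk⟩ := exists_nat_ge (2 * (l : ℝ))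
  obtain ⟨C, hC0, hC⟩ := (𝓕 v.toSchwartz).decay 0 0
  have h0 := (𝓕 w.toSchwartz).integrable_pow_mul volume 0
  have h1 := (𝓕 w.toSchwartz).integrable_pow_mul volume k
  have hb : Integrable (fun ξ : Eucl N =>
      C * (‖ξ‖ ^ 0 * ‖(𝓕 w.toSchwartz) ξ‖) +
        C * (2 * Real.pi) ^ k * (‖ξ‖ ^ k * ‖(𝓕 w.toSchwartz) ξ‖)) :=
    (h0.const_mul C).add (h1.const_mul _)
  refine hb.mono' ?_ (Filter.Eventually.of_forall fun ξ => ?_)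
  · refine Continuous.aestronglyMeasurable ?_
    refine Continuous.mul ?_ (Continuous.mul ?_ (𝓕 w.toSchwartz).continuous)
    · refine Complex.continuous_ofReal.comp ?_
      exact (by fun_prop : Continuous fun ξ : Eucl N => 2 * Real.pi * ‖ξ‖).rpow_const
        fun _ => Or.inr (by positivity)
    · exact Complex.continuous_conj.comp (𝓕 v.toSchwartz).continuous
  · have hv : ‖(𝓕 v.toSchwartz) ξ‖ ≤ C := by simpa using hC ξ
    have ht : (0 : ℝ) ≤ 2 * Real.pi * ‖ξ‖ := by positivity
    have hp : (2 * Real.pi * ‖ξ‖) ^ (2 * (l : ℝ)) ≤ 1 + (2 * Real.pi * ‖ξ‖) ^ k := by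
      rcases le_total (2 * Real.pi * ‖ξ‖) 1 with h | h
      · have := Real.rpow_le_one ht h (by positivity : (0 : ℝ) ≤ 2 * (l : ℝ))
        have := pow_nonneg ht k
        linarith
      · have := Real.rpow_le_rpow_of_exponent_le h hk
        rw [Real.rpow_natCast] at this
        linarith
    rw [norm_mul, norm_mul, RCLike.norm_conj, Complex.norm_real, Real.norm_of_nonneg
      (Real.rpow_nonneg ht _)]
    calc _ ≤ (1 + (2 * Real.pi * ‖ξ‖) ^ k) * (C * ‖(𝓕 w.toSchwartz) ξ‖) := by gcongr
      _ = _ := by rw [mul_pow]; ring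

/-- The inner product on test functions is a positive semidefinite Hermitian form. -/
@[reducible]
def homCore : PreInnerProductSpace.Core ℂ (HomTest N l) where
  inner := homInner
  conj_inner_symm := fun v w => by
    simp only [homInner]
    rw [← integral_conj]
    congr 1
    ext ξ
    simp only [map_mul, Complex.conj_conj, Complex.conj_ofReal]
    ring
  re_inner_nonneg := fun v => by
    simp only [homInner]
    have h : ∀ ξ : Eucl N,
        (((2 * Real.pi * ‖ξ‖) ^ (2 * (l : ℝ)) : ℝ) : ℂ) * (conj (𝓕 v.fn ξ) * 𝓕 v.fn ξ) =
          (((2 * Real.pi * ‖ξ‖) ^ (2 * (l : ℝ)) * ‖𝓕 v.fn ξ‖ ^ 2 : ℝ) : ℂ) := by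
      intro ξ
      rw [Complex.conj_mul']
      push_cast
      rfl
    simp only [h]
    rw [integral_complex_ofReal]
    exact integral_nonneg fun ξ => by positivity
  add_left := fun u v w => by
    simp only [homInner]
    rw [← integral_add (homInner_integrable u w) (homInner_integrable v w)]
    congr 1
    ext ξ
    rw [HomTest.fourier_add, map_add]
    ring
  smul_left := fun v w c => by
    simp only [homInner]
    rw [← integral_const_mul]
    congr 1
    ext ξ
    rw [HomTest.fourier_smul, map_mul]
    ring

instance : SeminormedAddCommGroup (HomTest N l) :=
  InnerProductSpace.Core.toSeminormedAddCommGroup (𝕜 := ℂ) (c := homCore)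

instance : InnerProductSpace ℂ (HomTest N l) := InnerProductSpace.ofCore homCore

/-- The homogeneous Sobolev space `𝕃^l(ℝ^N)`: the completion of `C_0^∞(ℝ^N)` in the metric
`‖(-Δ)^{l/2} v‖_{L₂}`. It is a complex Hilbert space. -/
abbrev HomSobolev (N : ℕ) (l : ℝ≥0) : Type := UniformSpace.Completion (HomTest N l)

/-- A test function as an element of `𝕃^l(ℝ^N)`. -/
def HomTest.toSobolev (v : HomTest N l) : HomSobolev N l := (v : UniformSpace.Completion (HomTest N l))

/-- The upper Ahlfors bound of order `s` with constant `A`: `μ(B(X,r)) ≤ A r^s` for `X` in the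
support of `μ` and `0 < r ≤ diam (supp μ)` (hence for all `r > 0` if the support is unbounded). -/
def UpperAhlfors (μ : Measure (Eucl N)) (s A : ℝ) : Prop :=
  ∀ X ∈ μ.support, ∀ r : ℝ, 0 < r → ENNReal.ofReal r ≤ Metric.ediam μ.support →
    μ (Metric.ball X r) ≤ ENNReal.ofReal (A * r ^ s)

/-- `S` is the bounded operator on `𝕃^l(ℝ^N)` defined by the quadratic form
`v ↦ ∫ V |v|² dμ`: the form is given by this (convergent) integral on the dense subspace
`C_0^∞(ℝ^N)`, and it is `v ↦ (S v, v)` there. -/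
def IsFormOperator (μ : Measure (Eucl N)) (V : Eucl N → ℂ)
    (S : HomSobolev N l →L[ℂ] HomSobolev N l) : Prop :=
  ∀ v : HomTest N l,
    Integrable (fun X => V X * (‖v.fn X‖ : ℂ) ^ 2) μ ∧
      inner ℂ v.toSobolev (S v.toSobolev) = ∫ X, V X * (‖v.fn X‖ : ℂ) ^ 2 ∂μ

section Counting

variable {H : Type*} [NormedAddCommGroup H] [InnerProductSpace ℂ H]

/-- `n_+(t, T)`: the number of eigenvalues of `T` greater than `t`, counted with multiplicity
(the dimension of the direct sum of the eigenspaces). -/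
def nPlus (t : ℝ) (T : H →L[ℂ] H) : ℕ∞ :=
  Cardinal.toENat (Module.rank ℂ
    ↥(⨆ a ∈ Set.Ioi t, Module.End.eigenspace (T : H →ₗ[ℂ] H) ((a : ℝ) : ℂ)))

/-- `n_-(t, T)`: the number of eigenvalues of `T` less than `-t`, counted with multiplicity. -/
def nMinus (t : ℝ) (T : H →L[ℂ] H) : ℕ∞ := nPlus t (-T)

/-- `n(t, T)`, for `t > 0`: the number of singular numbers of `T` greater than `t`, i.e. of numbers
`a > t` such that `a²` is an eigenvalue of `T* T`, counted with multiplicity. -/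
def nSing [CompleteSpace H] (t : ℝ) (T : H →L[ℂ] H) : ℕ∞ :=
  Cardinal.toENat (Module.rank ℂ
    ↥(⨆ a ∈ Set.Ioi t, Module.End.eigenspace
      ((ContinuousLinearMap.adjoint T ∘L T : H →L[ℂ] H) : H →ₗ[ℂ] H) (((a : ℝ) : ℂ) ^ 2)))

end Counting

end BirmanSchwinger

end

/-! Write `V = conj f₁ * f₂` with `|f₁| = |f₂| = |V|^{1/2}`. Then `S = T₁* T₂`, where `Tᵢ` is
multiplication by `fᵢ` from the Sobolev space to `L₂(μ)`. Everything reduces to one property of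
multiplication operators (`exists_isMulOperator`): for each `ε > 0`, `‖T u‖² ≤ ε ‖u‖²` off a
subspace of dimension at most `C A^{θ-1} ∫ |f|^{2θ} dμ · ε^{-θ}`. Compactness and all counting
bounds follow by linear algebra (`nPlus_le_finrank`, `nSing_le_finrank`).

The property comes from a Cwikel-type splitting (`exists_splitting`) in which the frequency cutoff
`2^{m(x)}` depends on the point through `|f(x)|`. Put `β = 2l - N + s`.

Low frequencies: by Cauchy–Schwarz, `v ↦ f(x) v_{<2^m}(x)` is a functional of squared norm at most
`C |f(x)|² 2^{m(N-2l)}` (`exists_norm_band_ball_sq_le`).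

High frequencies: Cauchy–Schwarz over dyadic annuli bounds `|v_{≥2^m}(x)|²` by `C 2^{-mβ}` times a
square function with weights `2^{kβ}`. The `μ`-integral of that function is at most `C A ‖v‖²`
(`exists_lintegral_squareFn_le`), because of the trace inequality `∫ |u|² dμ ≤ C A R^{N-s}
‖u‖²_{L₂}` for `u` with frequencies in `|ξ| ≤ R` (`exists_lintegral_synth_sq_le`), itself a `TT*`
argument with a Gaussian kernel and Schur's test.

Choosing `2^{mβ} ≈ A |f|²/t` makes the high part at most `C t ‖v‖²`. As `θ - 1 = (N-2l)/β`, the low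
part becomes a Hilbert–Schmidt field with squared norm at most `C (A/t)^{θ-1} ∫ |f|^{2θ} dμ`, hence
small off a subspace of controlled dimension (`exists_submodule_lintegral_le`). Taking `t`
proportional to `ε` gives the exponent `-θ`. -/

namespace BirmanSchwinger

/-! ### Hilbert–Schmidt fields and eigenvalue counting in an abstract Hilbert space. -/

section Hilbert

variable {H F : Type*} [NormedAddCommGroup H] [InnerProductSpace ℂ H] [NormedAddCommGroup F]
  [InnerProductSpace ℂ F]

theorem orthonormal_cons {n : ℕ} {e : Fin n → H} (he : Orthonormal ℂ e) {u : H} (hu : ‖u‖ = 1)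
    (h : ∀ i, inner ℂ (e i) u = 0) : Orthonormal ℂ (Fin.cons u e : Fin (n + 1) → H) := by
  refine ⟨fun i => ?_, fun i j hij => ?_⟩
  · refine Fin.cases ?_ (fun i => ?_) i
    · simpa using hu
    · simpa using he.1 i
  · induction i using Fin.cases with
    | zero =>
      induction j using Fin.cases with
      | zero => exact absurd rfl hij
      | succ j => simpa using inner_eq_zero_symm.1 (h j)
    | succ i =>
      induction j using Fin.cases with
      | zero => simpa using h i
      | succ j => simpa using he.2 (fun h' => hij (by rw [h']))

/-- A field of functionals whose squared norms are integrable defines a Hilbert–Schmidt operator;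
such an operator is small off a subspace of controlled dimension. -/
theorem exists_submodule_lintegral_le [CompleteSpace H] {X : Type*} [MeasurableSpace X]
    (μ : Measure X) (ℓ : X → H →L[ℂ] ℂ) (b : X → ℝ≥0∞) (hb : ∀ x, ‖ℓ x‖ₑ ^ 2 ≤ b x) {K ε : ℝ}
    (hK0 : 0 ≤ K) (hK : ∫⁻ x, b x ∂μ ≤ ENNReal.ofReal K) (hε : 0 < ε) :
    ∃ M : Submodule ℂ H, FiniteDimensional ℂ M ∧ (Module.finrank ℂ M : ℝ) * ε ≤ K ∧
      ∀ u ∈ Mᗮ, ∫⁻ x, ‖ℓ x u‖ₑ ^ 2 ∂μ ≤ ENNReal.ofReal (ε * ‖u‖ ^ 2) := by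
  -- Bessel's inequality for the vector representing `ℓ x`, integrated over `x`, bounds the length
  -- of any orthonormal system on which the form exceeds `ε`.
  have key : ∀ (n : ℕ) (e : Fin n → H), Orthonormal ℂ e →
      (∀ i, ENNReal.ofReal ε < ∫⁻ x, ‖ℓ x (e i)‖ₑ ^ 2 ∂μ) → (n : ℝ) * ε ≤ K := by
    intro n e he h
    have h1 : (n : ℝ≥0∞) * ENNReal.ofReal ε ≤ ∑ i, ∫⁻ x, ‖ℓ x (e i)‖ₑ ^ 2 ∂μ := by
      calc (n : ℝ≥0∞) * ENNReal.ofReal ε = ∑ _i : Fin n, ENNReal.ofReal ε := by simp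
        _ ≤ _ := Finset.sum_le_sum fun i _ => (h i).le
    have hsup : ∀ s : Finset (Fin n), ∑ i ∈ s, ∫⁻ x, ‖ℓ x (e i)‖ₑ ^ 2 ∂μ ≤
        ∫⁻ x, ∑ i ∈ s, ‖ℓ x (e i)‖ₑ ^ 2 ∂μ := by
      intro s
      induction s using Finset.induction_on with
      | empty => simp
      | insert a s ha ih =>
        simp only [Finset.sum_insert ha]
        -- The lower integral is superadditive without measurability. This matters: the fields used
        -- later depend on `x` through arbitrary choices.
        exact (add_le_add_right ih _).trans (le_lintegral_add _ _)
    have h2 : ∀ x, ∑ i, ‖ℓ x (e i)‖ₑ ^ 2 ≤ b x := by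
      intro x
      refine le_trans ?_ (hb x)
      set k : H := (InnerProductSpace.toDual ℂ H).symm (ℓ x) with hk
      have hkn : ‖k‖ = ‖ℓ x‖ := by simp [hk]
      have hb1 := he.sum_inner_products_le k (s := Finset.univ)
      have : ∀ i, ‖ℓ x (e i)‖ = ‖inner ℂ (e i) k‖ := by
        intro i
        rw [norm_inner_symm, hk, InnerProductSpace.toDual_symm_apply]
      simp only [← this, hkn] at hb1
      simp only [← ofReal_norm, ← ENNReal.ofReal_pow (norm_nonneg _)]
      rw [← ENNReal.ofReal_sum_of_nonneg (fun i _ => by positivity)]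
      exact ENNReal.ofReal_le_ofReal hb1
    have h3 := h1.trans ((hsup _).trans ((lintegral_mono h2).trans hK))
    rw [← ENNReal.ofReal_natCast, ← ENNReal.ofReal_mul (by positivity)] at h3
    exact (ENNReal.ofReal_le_ofReal_iff hK0).1 h3
  by_contra hno
  push Not at hno
  -- If no `M` worked, a system could be extended forever: by `key` its span is an admissible
  -- candidate for `M`, so its failure yields a new orthogonal vector.
  have build : ∀ n : ℕ, ∃ e : Fin n → H, Orthonormal ℂ e ∧
      ∀ i, ENNReal.ofReal ε < ∫⁻ x, ‖ℓ x (e i)‖ₑ ^ 2 ∂μ := by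
    intro n
    induction n with
    | zero => exact ⟨Fin.elim0, ⟨fun i => i.elim0, fun i => i.elim0⟩, fun i => i.elim0⟩
    | succ n ih =>
      obtain ⟨e, he, hei⟩ := ih
      have hfr : (Module.finrank ℂ (Submodule.span ℂ (Set.range e)) : ℝ) * ε ≤ K := by
        refine le_trans ?_ (key n e he hei)
        gcongr
        exact (finrank_range_le_card e).trans (by simp)
      obtain ⟨u, hu, hlt⟩ := hno (Submodule.span ℂ (Set.range e))
        (FiniteDimensional.span_of_finite ℂ (Set.finite_range e)) hfr
      have hu0 : u ≠ 0 := by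
        rintro rfl
        simp at hlt
      have hun : 0 < ‖u‖ := norm_pos_iff.2 hu0
      refine ⟨Fin.cons (((‖u‖⁻¹ : ℝ) : ℂ) • u) e, orthonormal_cons he ?_ ?_, ?_⟩
      · rw [norm_smul, Complex.norm_real, norm_inv, norm_norm, inv_mul_cancel₀ hun.ne']
      · intro i
        rw [inner_smul_right, (Submodule.mem_orthogonal _ _).1 hu _
          (Submodule.subset_span ⟨i, rfl⟩), mul_zero]
      · intro i
        induction i using Fin.cases with
        | succ i => simpa using hei i
        | zero =>
          simp only [Fin.cons_zero, map_smul, enorm_smul, mul_pow]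
          rw [lintegral_const_mul' _ _ (by simp)]
          have h1 : ‖((‖u‖⁻¹ : ℝ) : ℂ)‖ₑ ^ 2 = ENNReal.ofReal (‖u‖⁻¹ ^ 2) := by
            rw [← ofReal_norm, Complex.norm_real, norm_inv, norm_norm, ENNReal.ofReal_pow]
            positivity
          rw [h1]
          have h2 : ENNReal.ofReal ε =
              ENNReal.ofReal (‖u‖⁻¹ ^ 2) * ENNReal.ofReal (ε * ‖u‖ ^ 2) := by
            rw [← ENNReal.ofReal_mul (by positivity)]
            congr 1
            field_simp
          rw [h2]
          exact ENNReal.mul_lt_mul_right (by simp; positivity) (by simp) hlt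
  obtain ⟨n, hn⟩ := exists_nat_gt (K / ε)
  obtain ⟨e, he, hei⟩ := build n
  have := key n e he hei
  rw [div_lt_iff₀ hε] at hn
  linarith

/-- An operator that is arbitrarily small off finite-dimensional subspaces is compact. -/
theorem isCompactOperator_of_small_off_finite (T : H →L[ℂ] F)
    [CompleteSpace F]
    (h : ∀ ε : ℝ, 0 < ε → ∃ M : Submodule ℂ H, FiniteDimensional ℂ M ∧
      ∀ u ∈ Mᗮ, ‖T u‖ ^ 2 ≤ ε * ‖u‖ ^ 2) : IsCompactOperator T := by
  have hcl := isClosed_setOfPred_isCompactOperator (σ₁₂ := RingHom.id ℂ) (M₁ := H) (M₂ := F)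
  have hmem : T ∈ closure {f : H →L[ℂ] F | IsCompactOperator f} := by
    rw [Metric.mem_closure_iff]
    intro δ hδ
    obtain ⟨M, hM, hTM⟩ := h ((δ / 2) ^ 2) (by positivity)
    refine ⟨T ∘L M.starProjection, ?_, ?_⟩
    · have := FiniteDimensional.proper ℂ M
      have hc : IsCompactOperator (M.orthogonalProjectionOnto : H →L[ℂ] M) :=
        isCompactOperator_of_locallyCompactSpace_dom M.orthogonalProjectionOnto
      have := hc.clm_comp (T ∘L M.subtypeL)
      exact this
    · rw [dist_eq_norm]
      refine lt_of_le_of_lt (ContinuousLinearMap.opNorm_le_bound _ (by positivity)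
        (fun u => ?_) : _ ≤ δ / 2) (by linarith)
      have h1 := hTM _ (M.sub_starProjection_mem_orthogonal u)
      have h2 : ‖u - M.starProjection u‖ ≤ ‖u‖ := by
        rw [← Submodule.starProjection_orthogonal_val]
        exact Submodule.norm_starProjection_apply_le _ _
      have h3 : (T - T ∘L M.starProjection) u = T (u - M.starProjection u) := by simp
      rw [h3]
      refine abs_le_of_sq_le_sq' ?_ (by positivity) |>.2
      calc _ ≤ _ := h1
        _ ≤ (δ / 2) ^ 2 * ‖u‖ ^ 2 := by gcongr
        _ = _ := by ring
  exact hcl.closure_subset hmem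

/-- Eigenspaces of a symmetric operator are mutually orthogonal, so both sides split over the
eigencomponents of `u`, each with eigenvalue at least `τ`. -/
theorem le_re_inner_of_mem_iSup_eigenspace {P : H →ₗ[ℂ] H} (hP : P.IsSymmetric) {τ : ℝ} {u : H}
    (hu : u ∈ ⨆ b ∈ Set.Ici τ, Module.End.eigenspace P ((b : ℝ) : ℂ)) :
    τ * ‖u‖ ^ 2 ≤ (inner ℂ u (P u)).re := by
  classical
  rw [iSup_subtype', Submodule.mem_iSup_iff_exists_finsupp] at hu
  obtain ⟨f, hf, rfl⟩ := hu
  have horth : OrthogonalFamily ℂ (fun b : Set.Ici τ => Module.End.eigenspace P ((b : ℝ) : ℂ))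
      (fun b => (Module.End.eigenspace P ((b : ℝ) : ℂ)).subtypeₗᵢ) :=
    hP.orthogonalFamily_eigenspaces.comp (f := fun b : Set.Ici τ => ((b : ℝ) : ℂ))
      (fun a b hab => Subtype.ext (Complex.ofReal_injective hab))
  set g : ∀ b : Set.Ici τ, Module.End.eigenspace P ((b : ℝ) : ℂ) := fun b => ⟨f b, hf b⟩ with hg
  have h1 := horth.norm_sum g f.support
  have h2 := horth.inner_sum g (fun b => ((b : ℝ) : ℂ) • g b) f.support
  have h3 : ∑ b ∈ f.support, (Module.End.eigenspace P ((b : ℝ) : ℂ)).subtypeₗᵢ (g b) =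
      f.sum fun _ x => x := rfl
  have h4 : ∑ b ∈ f.support, (Module.End.eigenspace P ((b : ℝ) : ℂ)).subtypeₗᵢ
      (((b : ℝ) : ℂ) • g b) = P (f.sum fun _ x => x) := by
    rw [Finsupp.sum, map_sum]
    refine Finset.sum_congr rfl fun b _ => ?_
    exact (Module.End.mem_eigenspace_iff.1 (hf b)).symm
  rw [h3] at h1 h2
  rw [h4] at h2
  rw [h1, h2, Complex.re_sum, Finset.mul_sum]
  refine Finset.sum_le_sum fun b _ => ?_
  rw [inner_smul_right, inner_self_eq_norm_sq_to_K]
  have : ((b : ℝ) : ℂ) * ((‖g b‖ : ℝ) : ℂ) ^ 2 = ((b * ‖g b‖ ^ 2 : ℝ) : ℂ) := by push_cast; rfl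
  erw [this, Complex.ofReal_re]
  have := b.2
  simp only [Set.mem_Ici] at this
  gcongr

theorem toENat_rank_le_finrank {L : Submodule ℂ H} {E : Type*} [AddCommGroup E]
    [Module ℂ E] [FiniteDimensional ℂ E] (f : H →ₗ[ℂ] E)
    (hf : ∀ u ∈ L, f u = 0 → u = 0) :
    Cardinal.toENat (Module.rank ℂ L) ≤ (Module.finrank ℂ E : ℕ∞) := by
  have hinj : Function.Injective (f ∘ₗ L.subtype) := by
    rw [← LinearMap.ker_eq_bot, LinearMap.ker_eq_bot']
    intro u hu
    exact Subtype.ext (hf u u.2 hu)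
  have := FiniteDimensional.of_injective (V₂ := E) (f ∘ₗ L.subtype) hinj
  rw [← Module.finrank_eq_rank, Cardinal.toENat_nat]
  exact_mod_cast LinearMap.finrank_le_finrank_of_injective hinj

/-- If the form of `S` is dominated by `‖T u‖²` and `T` is small off `M`, then `S` has at most
`dim M` large eigenvalues. -/
theorem nPlus_le_finrank {S : H →L[ℂ] H} (hS : (S : H →ₗ[ℂ] H).IsSymmetric) {T : H →L[ℂ] F}
    (hST : ∀ u, (inner ℂ u (S u)).re ≤ ‖T u‖ ^ 2) {t ε : ℝ} (hε : ε < t) {M : Submodule ℂ H}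
    [FiniteDimensional ℂ M] (hM : ∀ u ∈ Mᗮ, ‖T u‖ ^ 2 ≤ ε * ‖u‖ ^ 2) :
    nPlus t S ≤ (Module.finrank ℂ M : ℕ∞) := by
  refine toENat_rank_le_finrank (M.orthogonalProjectionOnto : H →ₗ[ℂ] M) fun u hu h0 => ?_
  have hu' : u ∈ Mᗮ := (Submodule.orthogonalProjectionOnto_eq_zero_iff (K := M)).1 h0
  have h1 : t * ‖u‖ ^ 2 ≤ (inner ℂ u (S u)).re :=
    le_re_inner_of_mem_iSup_eigenspace hS
      ((iSup₂_le fun a ha => le_iSup₂_of_le (f := fun (b : ℝ) (_ : b ∈ Set.Ici t) =>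
        Module.End.eigenspace (S : H →ₗ[ℂ] H) (b : ℂ)) a (Set.Ioi_subset_Ici_self ha) le_rfl :
        (⨆ a ∈ Set.Ioi t, Module.End.eigenspace (S : H →ₗ[ℂ] H) ((a : ℝ) : ℂ)) ≤ _) hu)
  by_contra hne
  have : 0 < ‖u‖ ^ 2 := by positivity
  nlinarith [hST u, hM u hu']

/-- Since `S` need not be symmetric, smallness of `T` is needed at both `u` and `S u`. Requiring
both to be orthogonal to `M` costs `2 dim M` conditions. Then `‖S u‖² ≤ ‖T (S u)‖ ‖T u‖ ≤ ε ‖S u‖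
‖u‖`, while `‖S u‖ ≥ t ‖u‖` on the singular subspace, which forces `u = 0`. -/
theorem nSing_le_finrank [CompleteSpace H] {S : H →L[ℂ] H} {T : H →L[ℂ] F}
    (hST : ∀ u w, ‖inner ℂ w (S u)‖ ≤ ‖T w‖ * ‖T u‖) {t ε : ℝ} (hε0 : 0 ≤ ε) (hε : ε < t)
    {M : Submodule ℂ H} [FiniteDimensional ℂ M] (hM : ∀ u ∈ Mᗮ, ‖T u‖ ^ 2 ≤ ε * ‖u‖ ^ 2) :
    nSing t S ≤ ((2 * Module.finrank ℂ M : ℕ) : ℕ∞) := by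
  have ht : 0 < t := hε0.trans_lt hε
  have hsym : ((ContinuousLinearMap.adjoint S ∘L S : H →L[ℂ] H) : H →ₗ[ℂ] H).IsSymmetric := by
    intro u v
    simp only [ContinuousLinearMap.coe_coe, ContinuousLinearMap.comp_apply]
    rw [ContinuousLinearMap.adjoint_inner_left, ContinuousLinearMap.adjoint_inner_right]
  rw [two_mul, ← Module.finrank_prod (R := ℂ) (M := M) (M' := M)]
  refine toENat_rank_le_finrank ((M.orthogonalProjectionOnto : H →ₗ[ℂ] M).prod
    ((M.orthogonalProjectionOnto ∘L S : H →L[ℂ] M) : H →ₗ[ℂ] M)) fun u hu h0 => ?_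
  have h0' := Prod.ext_iff.1 h0
  have hu' : u ∈ Mᗮ := (Submodule.orthogonalProjectionOnto_eq_zero_iff (K := M)).1 h0'.1
  have hSu : S u ∈ Mᗮ := (Submodule.orthogonalProjectionOnto_eq_zero_iff (K := M)).1 h0'.2
  have hle : (⨆ a ∈ Set.Ioi t, Module.End.eigenspace
      ((ContinuousLinearMap.adjoint S ∘L S : H →L[ℂ] H) : H →ₗ[ℂ] H) (((a : ℝ) : ℂ) ^ 2)) ≤
      ⨆ b ∈ Set.Ici (t ^ 2), Module.End.eigenspace
      ((ContinuousLinearMap.adjoint S ∘L S : H →L[ℂ] H) : H →ₗ[ℂ] H) ((b : ℝ) : ℂ) := by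
    refine iSup₂_le fun a ha => le_iSup₂_of_le (a ^ 2) ?_ (by push_cast; exact le_rfl)
    simp only [Set.mem_Ioi, Set.mem_Ici] at ha ⊢
    gcongr
  have h1 := le_re_inner_of_mem_iSup_eigenspace hsym (hle hu)
  rw [ContinuousLinearMap.coe_coe, ContinuousLinearMap.comp_apply,
    ContinuousLinearMap.adjoint_inner_right, inner_self_eq_norm_sq_to_K] at h1
  have h2 : t ^ 2 * ‖u‖ ^ 2 ≤ ‖S u‖ ^ 2 := by exact_mod_cast h1
  have h3 := hST u (S u)
  rw [inner_self_eq_norm_sq_to_K] at h3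
  have h3' : ‖S u‖ ^ 2 ≤ ‖T (S u)‖ * ‖T u‖ := by simpa using h3
  have h4 := hM u hu'
  have h5 := hM _ hSu
  by_contra hne
  have hun : 0 < ‖u‖ := norm_pos_iff.2 hne
  have hSun : 0 < ‖S u‖ := by
    have : 0 < ‖S u‖ ^ 2 := lt_of_lt_of_le (by positivity) h2
    exact (norm_nonneg _).lt_of_ne' fun h => by simp [h] at this
  have h6 : (‖S u‖ ^ 2) ^ 2 ≤ (ε * ‖S u‖ ^ 2) * (ε * ‖u‖ ^ 2) := by
    calc (‖S u‖ ^ 2) ^ 2 ≤ (‖T (S u)‖ * ‖T u‖) ^ 2 := by gcongr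
      _ = ‖T (S u)‖ ^ 2 * ‖T u‖ ^ 2 := by ring
      _ ≤ _ := by gcongr
  have h7 : ‖S u‖ ^ 2 ≤ ε ^ 2 * ‖u‖ ^ 2 := by
    have : ‖S u‖ ^ 2 * ‖S u‖ ^ 2 ≤ (ε ^ 2 * ‖u‖ ^ 2) * ‖S u‖ ^ 2 := by linarith
    exact le_of_mul_le_mul_right this (by positivity)
  have h8 : ε ^ 2 < t ^ 2 := by gcongr
  have : ε ^ 2 * ‖u‖ ^ 2 < t ^ 2 * ‖u‖ ^ 2 := by gcongr
  linarith

end Hilbert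

end BirmanSchwinger

namespace BirmanSchwinger

/-! ### Ahlfors bounds at all scales and Gaussian integrals against `μ`. -/

section Measure

/-- The upper Ahlfors bound at all scales. -/
def GlobalAhlfors {N : ℕ} (μ : Measure (Eucl N)) (s A : ℝ) : Prop :=
  ∀ X ∈ μ.support, ∀ r : ℝ, 0 < r → μ (Metric.ball X r) ≤ ENNReal.ofReal (A * r ^ s)

/-- Compactness of the unit ball, then translation and scaling; one finite set serves all centres
and radii. -/
theorem exists_finset_closedBall_subset (N : ℕ) : ∃ t : Finset (Eucl N), ∀ (X : Eucl N) (d : ℝ),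
    0 < d → Metric.closedBall X d ⊆ ⋃ p ∈ t, Metric.ball (X + d • p) (d / 2) := by
  obtain ⟨t, -, htf, ht⟩ := (isCompact_closedBall (0 : Eucl N) 1).finite_cover_balls
    (e := 1 / 2) (by norm_num)
  refine ⟨htf.toFinset, fun X d hd y hy => ?_⟩
  have hmem : d⁻¹ • (y - X) ∈ Metric.closedBall (0 : Eucl N) 1 := by
    rw [mem_closedBall_zero_iff, norm_smul, norm_inv, Real.norm_of_nonneg hd.le,
      inv_mul_le_iff₀ hd, mul_one, ← dist_eq_norm]
    exact hy
  obtain ⟨p, hp, hyp⟩ := Set.mem_iUnion₂.1 (ht hmem)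
  refine Set.mem_iUnion₂.2 ⟨p, by simpa using hp, ?_⟩
  rw [Metric.mem_ball, dist_eq_norm] at hyp ⊢
  have : y - (X + d • p) = d • (d⁻¹ • (y - X) - p) := by
    rw [smul_sub, smul_smul, mul_inv_cancel₀ hd.ne', one_smul]
    abel
  rw [this, norm_smul, Real.norm_of_nonneg hd.le]
  nlinarith

/-- Beyond the diameter `d` the ball captures at most the total mass, which is bounded by covering
the support with boundedly many balls of radius `d/2`. Having more than one support point ensures `d
> 0`. -/
theorem exists_globalAhlfors (N : ℕ) (s : ℝ) (hs : 0 < s) : ∃ C : ℝ, 1 ≤ C ∧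
    ∀ (μ : Measure (Eucl N)) (A : ℝ), 0 < A → UpperAhlfors μ s A → (∀ X, μ.support ≠ {X}) →
      GlobalAhlfors μ s (C * A) := by
  obtain ⟨t, ht⟩ := exists_finset_closedBall_subset N
  refine ⟨(t.card : ℝ) + 1, by simp, fun μ A hA hμ hne X hX r hr => ?_⟩
  have hmono : ∀ d, 0 ≤ d → d ≤ r → A * d ^ s ≤ (t.card + 1 : ℝ) * A * r ^ s := by
    intro d hd hdr
    have h1 : d ^ s ≤ r ^ s := Real.rpow_le_rpow hd hdr hs.le
    have h2 : 0 ≤ r ^ s := by positivity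
    have h3 : 0 ≤ (t.card : ℝ) * A * r ^ s := by positivity
    nlinarith
  rcases le_or_gt (ENNReal.ofReal r) (Metric.ediam μ.support) with h | h
  · exact (hμ X hX r hr h).trans (ENNReal.ofReal_le_ofReal (hmono r hr.le le_rfl))
  have hfin : Metric.ediam μ.support ≠ ⊤ := h.ne_top
  obtain ⟨Y, hY, hYX⟩ : ∃ Y ∈ μ.support, Y ≠ X := by
    by_contra! hcon
    exact hne X (Set.eq_singleton_iff_unique_mem.2 ⟨hX, hcon⟩)
  have hpos : 0 < Metric.ediam μ.support :=
    (edist_pos.2 hYX).trans_le (Metric.edist_le_ediam_of_mem hY hX)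
  set d := (Metric.ediam μ.support).toReal with hd
  have hd0 : 0 < d := ENNReal.toReal_pos hpos.ne' hfin
  have hdof : ENNReal.ofReal d = Metric.ediam μ.support := ENNReal.ofReal_toReal hfin
  have hdr : d ≤ r := by
    rw [← hdof] at h
    exact (ENNReal.ofReal_le_ofReal_iff hr.le).1 h.le
  have hsub : μ.support ⊆ Metric.closedBall X d := by
    intro Z hZ
    rw [Metric.mem_closedBall, dist_edist]
    exact ENNReal.toReal_mono hfin (Metric.edist_le_ediam_of_mem hZ hX)
  have hball : ∀ p ∈ t, μ (μ.support ∩ Metric.ball (X + d • p) (d / 2)) ≤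
      ENNReal.ofReal (A * d ^ s) := by
    intro p _
    rcases (μ.support ∩ Metric.ball (X + d • p) (d / 2)).eq_empty_or_nonempty with he | ⟨q, hq, hqb⟩
    · simp [he]
    -- The covering balls need not be centred on the support; radius `d/2` lets each be enlarged to
    -- a ball of radius `d` about one of its support points.
    · refine (measure_mono ?_).trans (hμ q hq d hd0 hdof.le)
      rintro z ⟨-, hz⟩
      rw [Metric.mem_ball] at *
      linarith [dist_triangle_right z q (X + d • p)]
  calc μ (Metric.ball X r) ≤ μ (⋃ p ∈ t, μ.support ∩ Metric.ball (X + d • p) (d / 2)) := by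
        refine measure_mono_ae ?_
        filter_upwards [μ.support_mem_ae] with z hz _
        obtain ⟨p, hp, hzp⟩ := Set.mem_iUnion₂.1 (ht X d hd0 (hsub hz))
        exact Set.mem_iUnion₂.2 ⟨p, hp, hz, hzp⟩
    _ ≤ ∑ p ∈ t, μ (μ.support ∩ Metric.ball (X + d • p) (d / 2)) := measure_biUnion_finset_le _ _
    _ ≤ ∑ p ∈ t, ENNReal.ofReal (A * d ^ s) := Finset.sum_le_sum hball
    _ = ENNReal.ofReal (t.card * (A * d ^ s)) := by
        rw [Finset.sum_const, nsmul_eq_mul,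
          ENNReal.ofReal_mul (p := (t.card : ℝ)) (by positivity), ENNReal.ofReal_natCast]
    _ ≤ _ := ENNReal.ofReal_le_ofReal (by
        have h1 := Real.rpow_le_rpow hd0.le hdr hs.le
        have h2 : 0 ≤ r ^ s := by positivity
        have h3 : (t.card : ℝ) * (A * d ^ s) ≤ t.card * (A * r ^ s) := by gcongr
        nlinarith [mul_nonneg hA.le h2])

theorem GlobalAhlfors.isLocallyFiniteMeasure {N : ℕ} {μ : Measure (Eucl N)} {s A : ℝ}
    (h : GlobalAhlfors μ s A) : IsLocallyFiniteMeasure μ := by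
  refine ⟨fun X => ?_⟩
  by_cases hX : X ∈ μ.support
  · exact ⟨Metric.ball X 1, Metric.ball_mem_nhds _ one_pos,
      (h X hX 1 one_pos).trans_lt ENNReal.ofReal_lt_top⟩
  · obtain ⟨U, hU, hU0⟩ := Measure.notMem_support_iff_exists.1 hX
    exact ⟨U, hU, by simp [hU0]⟩

theorem summable_exp_neg_mul_nat_sq_mul_rpow {a : ℝ} (ha : 0 < a) (s : ℝ) :
    Summable fun j : ℕ => Real.exp (-a * (j : ℝ) ^ 2) * ((j : ℝ) + 1) ^ s := by
  obtain ⟨k, hk⟩ := exists_nat_ge s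
  have h0 : Summable fun j : ℕ => (((j + 1 : ℕ) : ℝ)) ^ k * Real.exp (-a * ((j + 1 : ℕ) : ℝ)) :=
    (summable_nat_add_iff (f := fun j : ℕ => ((j : ℝ)) ^ k * Real.exp (-a * (j : ℝ))) 1).2
      (Real.summable_pow_mul_exp_neg_nat_mul k ha)
  refine Summable.of_nonneg_of_le (fun j => by positivity) (fun j => ?_)
    (h0.mul_left (Real.exp a))
  have h1 : ((j : ℝ) + 1) ^ s ≤ ((j : ℝ) + 1) ^ k := by
    rw [← Real.rpow_natCast]
    exact Real.rpow_le_rpow_of_exponent_le (by linarith [(Nat.cast_nonneg j : (0 : ℝ) ≤ j)]) hk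
  have h2 : Real.exp (-a * (j : ℝ) ^ 2) ≤ Real.exp a * Real.exp (-a * ((j : ℝ) + 1)) := by
    rw [← Real.exp_add]
    refine Real.exp_le_exp.2 ?_
    have : (j : ℝ) ≤ (j : ℝ) ^ 2 := by
      rcases Nat.eq_zero_or_pos j with rfl | hj
      · simp
      · have : (1 : ℝ) ≤ j := by exact_mod_cast hj
        nlinarith
    nlinarith
  push_cast
  calc _ ≤ (Real.exp a * Real.exp (-a * ((j : ℝ) + 1))) * ((j : ℝ) + 1) ^ k := by gcongr
    _ = _ := by ring

/-- Cut space into shells `j ≤ R‖X - y‖ < j + 1`: each lies in a ball of radius `(j+1)/R`, and the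
Gaussian decay beats the growth `(j+1)^s`. -/
theorem exists_lintegral_gaussian_le (s : ℝ) {a : ℝ} (ha : 0 < a) : ∃ C : ℝ, 0 < C ∧
    ∀ {N : ℕ} (μ : Measure (Eucl N)) (A : ℝ), 0 < A → GlobalAhlfors μ s A →
      ∀ X ∈ μ.support, ∀ R : ℝ, 0 < R →
        ∫⁻ y, ENNReal.ofReal (Real.exp (-a * (R * ‖X - y‖) ^ 2)) ∂μ ≤
          ENNReal.ofReal (C * A * R ^ (-s)) := by
  have hsum := summable_exp_neg_mul_nat_sq_mul_rpow ha s
  refine ⟨∑' j : ℕ, Real.exp (-a * (j : ℝ) ^ 2) * ((j : ℝ) + 1) ^ s,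
    hsum.tsum_pos (fun j => by positivity) 0 (by positivity), fun {N} μ A hA hμ X hX R hR => ?_⟩
  have hpt : ∀ y, ENNReal.ofReal (Real.exp (-a * (R * ‖X - y‖) ^ 2)) ≤
      ∑' j : ℕ, (Metric.ball X (((j : ℝ) + 1) / R)).indicator
        (fun _ => ENNReal.ofReal (Real.exp (-a * (j : ℝ) ^ 2))) y := by
    intro y
    set j := ⌊R * ‖X - y‖⌋₊ with hj
    refine le_trans ?_ (ENNReal.le_tsum j)
    have h0 : (0 : ℝ) ≤ R * ‖X - y‖ := by positivity
    have hlt : R * ‖X - y‖ < j + 1 := Nat.lt_floor_add_one _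
    have hle : (j : ℝ) ≤ R * ‖X - y‖ := Nat.floor_le h0
    rw [Set.indicator_of_mem]
    · refine ENNReal.ofReal_le_ofReal (Real.exp_le_exp.2 ?_)
      have : (j : ℝ) ^ 2 ≤ (R * ‖X - y‖) ^ 2 := by gcongr
      nlinarith
    · rw [Metric.mem_ball, dist_comm, dist_eq_norm, lt_div_iff₀ hR]
      linarith
  calc _ ≤ ∫⁻ y, ∑' j : ℕ, (Metric.ball X (((j : ℝ) + 1) / R)).indicator
        (fun _ => ENNReal.ofReal (Real.exp (-a * (j : ℝ) ^ 2))) y ∂μ := lintegral_mono hpt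
    _ = ∑' j : ℕ, ENNReal.ofReal (Real.exp (-a * (j : ℝ) ^ 2)) *
          μ (Metric.ball X (((j : ℝ) + 1) / R)) := by
        rw [lintegral_tsum fun j => (measurable_const.indicator measurableSet_ball).aemeasurable]
        refine tsum_congr fun j => ?_
        rw [lintegral_indicator_const measurableSet_ball]
    _ ≤ ∑' j : ℕ, ENNReal.ofReal ((Real.exp (-a * (j : ℝ) ^ 2) * ((j : ℝ) + 1) ^ s) *
          (A * R ^ (-s))) := by
        refine ENNReal.tsum_le_tsum fun j => ?_
        have h := hμ X hX (((j : ℝ) + 1) / R) (by positivity)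
        calc _ ≤ ENNReal.ofReal (Real.exp (-a * (j : ℝ) ^ 2)) *
              ENNReal.ofReal (A * (((j : ℝ) + 1) / R) ^ s) := by gcongr
          _ = _ := by
              rw [← ENNReal.ofReal_mul (by positivity), Real.div_rpow (by positivity) hR.le,
                Real.rpow_neg hR.le]
              congr 1
              ring
    _ = _ := by
        rw [← ENNReal.ofReal_tsum_of_nonneg (fun j => by positivity) (hsum.mul_right _),
          tsum_mul_right, mul_assoc]

end Measure

end BirmanSchwinger

noncomputable section

namespace BirmanSchwinger

/-! ### The trace inequality for band-limited functions. -/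

section Trace

variable {N : ℕ}

/-- The plane wave `e^{2πi x·ξ}`. -/
def wave (x ξ : Eucl N) : ℂ := (Real.fourierChar (inner ℝ x ξ) : Circle)

@[simp]
theorem norm_wave (x ξ : Eucl N) : ‖wave x ξ‖ = 1 := Circle.norm_coe _

theorem continuous_wave {α : Type*} [TopologicalSpace α] {f g : α → Eucl N} (hf : Continuous f)
    (hg : Continuous g) : Continuous fun a => wave (f a) (g a) :=
  continuous_subtype_val.comp (Real.continuous_fourierChar.comp (hf.inner hg))

theorem continuous_wave_left (ξ : Eucl N) : Continuous fun x : Eucl N => wave x ξ :=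
  continuous_wave continuous_id continuous_const

theorem continuous_wave_right (x : Eucl N) : Continuous fun ξ : Eucl N => wave x ξ :=
  continuous_wave continuous_const continuous_id

theorem wave_sub (x y ξ : Eucl N) : wave (x - y) ξ = wave x ξ * conj (wave y ξ) := by
  rw [wave, wave, wave, inner_sub_left, sub_eq_add_neg, AddChar.map_add_eq_mul,
    AddChar.map_neg_eq_inv, Circle.coe_mul, Circle.coe_inv_eq_conj]

theorem integrable_exp_neg_mul_sq {b : ℝ} (hb : 0 < b) :
    Integrable fun ξ : Eucl N => Real.exp (-b * ‖ξ‖ ^ 2) := by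
  have h := GaussianFourier.integrable_cexp_neg_mul_sq_norm_add (V := Eucl N) (b := (b : ℂ))
    (by simpa using hb) 0 0
  refine h.norm.congr (Filter.Eventually.of_forall fun ξ => ?_)
  simp only [Complex.norm_exp]
  congr 1
  simp [← Complex.ofReal_pow]

theorem integral_gaussian_mul_conj_wave {b : ℝ} (hb : 0 < b) (z : Eucl N) :
    ∫ ξ : Eucl N, ((Real.exp (-b * ‖ξ‖ ^ 2) : ℝ) : ℂ) * conj (wave z ξ) =
      (((Real.pi / b) ^ ((N : ℝ) / 2) * Real.exp (-(Real.pi ^ 2 / b) * ‖z‖ ^ 2) : ℝ) : ℂ) := by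
  have h := fourier_gaussian_innerProductSpace (V := Eucl N) (b := (b : ℂ)) (by simpa using hb) z
  rw [Real.fourier_eq] at h
  have hL : ∀ ξ : Eucl N, ((Real.exp (-b * ‖ξ‖ ^ 2) : ℝ) : ℂ) * conj (wave z ξ) =
      Real.fourierChar (-inner ℝ ξ z) • Complex.exp (-b * (‖ξ‖ : ℂ) ^ 2) := by
    intro ξ
    rw [Circle.smul_def, AddChar.map_neg_eq_inv, Circle.coe_inv_eq_conj, smul_eq_mul, mul_comm,
      wave, real_inner_comm]
    push_cast
    rfl
  simp only [hL]
  rw [h, finrank_euclideanSpace_fin]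
  push_cast
  rw [Complex.ofReal_cpow (by positivity)]
  push_cast
  congr 2
  ring

/-- The Fourier–Stieltjes transform of `w ν`. -/
def waveTransform (ν : Measure (Eucl N)) (w : Eucl N → ℂ) (ξ : Eucl N) : ℂ :=
  ∫ x, conj (wave x ξ) * w x ∂ν

theorem integrable_conj_wave_mul {ν : Measure (Eucl N)} {w : Eucl N → ℂ} (hw : Integrable w ν)
    (ξ : Eucl N) : Integrable (fun x => conj (wave x ξ) * w x) ν :=
  hw.bdd_mul (c := 1)
    (Complex.continuous_conj.comp (continuous_wave_left ξ)).aestronglyMeasurable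
    (Filter.Eventually.of_forall fun x => by simp)

theorem continuous_waveTransform {ν : Measure (Eucl N)} {w : Eucl N → ℂ} (hw : Integrable w ν) :
    Continuous (waveTransform ν w) :=
  continuous_of_dominated (bound := fun x => ‖w x‖)
    (fun ξ => (integrable_conj_wave_mul hw ξ).aestronglyMeasurable)
    (fun ξ => Filter.Eventually.of_forall fun x => by simp) hw.norm
    (Filter.Eventually.of_forall fun x =>
      (Complex.continuous_conj.comp (continuous_wave_right x)).mul continuous_const)

theorem norm_waveTransform_le (ν : Measure (Eucl N)) (w : Eucl N → ℂ) (ξ : Eucl N) :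
    ‖waveTransform ν w ξ‖ ≤ ∫ x, ‖w x‖ ∂ν :=
  (norm_integral_le_integral_norm _).trans (by simp)

theorem integrable_gaussian_mul_waveTransform_sq {ν : Measure (Eucl N)} {w : Eucl N → ℂ}
    (hw : Integrable w ν) {b : ℝ} (hb : 0 < b) :
    Integrable fun ξ : Eucl N => Real.exp (-b * ‖ξ‖ ^ 2) * ‖waveTransform ν w ξ‖ ^ 2 :=
  (integrable_exp_neg_mul_sq hb).mul_bdd (c := (∫ x, ‖w x‖ ∂ν) ^ 2)
    ((continuous_waveTransform hw).norm.pow 2).aestronglyMeasurable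
    (Filter.Eventually.of_forall fun ξ => by
      rw [norm_pow, norm_norm]
      gcongr
      exact norm_waveTransform_le ν w ξ)

theorem integrable_uncurry_wave_sub_mul {ν : Measure (Eucl N)} [IsFiniteMeasure ν]
    {G w : Eucl N → ℂ} (hGi : Integrable G)
    (hww : Integrable (fun p : Eucl N × Eucl N => w p.1 * conj (w p.2)) (ν.prod ν)) :
    Integrable (Function.uncurry fun (ξ : Eucl N) (p : Eucl N × Eucl N) =>
      G ξ * conj (wave (p.1 - p.2) ξ) * (w p.1 * conj (w p.2))) (volume.prod (ν.prod ν)) := by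
  have h1 : Continuous fun q : Eucl N × (Eucl N × Eucl N) => q.2.1 - q.2.2 :=
    (continuous_fst.comp continuous_snd).sub (continuous_snd.comp continuous_snd)
  have h2 := continuous_wave h1 (continuous_fst (X := Eucl N) (Y := Eucl N × Eucl N))
  have hc : Continuous fun q : Eucl N × (Eucl N × Eucl N) => conj (wave (q.2.1 - q.2.2) q.1) :=
    Complex.continuous_conj.comp h2
  have h := (hGi.mul_prod hww).bdd_mul (c := 1) hc.aestronglyMeasurable
    (Filter.Eventually.of_forall fun q => by simp)
  refine h.congr (Filter.Eventually.of_forall fun q => ?_)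
  simp only [Function.uncurry]
  ring

/-- The `TT*` estimate: the Gaussian-weighted `L²` norm of a Fourier–Stieltjes transform is
controlled by Schur's test. -/
theorem integral_gaussian_mul_waveTransform_sq_le {ν : Measure (Eucl N)} [IsFiniteMeasure ν]
    {w : Eucl N → ℂ} (hw : Continuous w) {B : ℝ} (hwB : ∀ x, ‖w x‖ ≤ B) {b M : ℝ} (hb : 0 < b)
    (hM : ∀ᵐ x ∂ν, ∫ y, Real.exp (-(Real.pi ^ 2 / b) * ‖x - y‖ ^ 2) ∂ν ≤ M) :
    ∫ ξ : Eucl N, Real.exp (-b * ‖ξ‖ ^ 2) * ‖waveTransform ν w ξ‖ ^ 2 ≤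
      (Real.pi / b) ^ ((N : ℝ) / 2) * M * ∫ x, ‖w x‖ ^ 2 ∂ν := by
  have hB : 0 ≤ B := (norm_nonneg _).trans (hwB 0)
  have hwi : Integrable w ν := .of_bound hw.aestronglyMeasurable B
    (Filter.Eventually.of_forall hwB)
  set κ : Eucl N → ℝ := fun z => Real.exp (-(Real.pi ^ 2 / b) * ‖z‖ ^ 2) with hκ
  have hκc : Continuous κ := by fun_prop
  have hκ1 : ∀ z, κ z ≤ 1 := fun z => Real.exp_le_one_iff.2 (by
    rw [neg_mul, neg_nonpos]; positivity)
  set G : Eucl N → ℂ := fun ξ => ((Real.exp (-b * ‖ξ‖ ^ 2) : ℝ) : ℂ) with hG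
  have hGi : Integrable G := (integrable_exp_neg_mul_sq hb).ofReal
  have hww : Integrable (fun p : Eucl N × Eucl N => w p.1 * conj (w p.2)) (ν.prod ν) :=
    hwi.mul_prod ((RCLike.conjCLE (K := ℂ)).toContinuousLinearMap.integrable_comp hwi)
  -- Opening the square as a double integral over `ν ⊗ ν` lets Fubini carry out the `ξ`-integration
  -- first, leaving the Gaussian kernel `κ (x - y)`.
  have h1 : ∀ ξ, G ξ * ((‖waveTransform ν w ξ‖ ^ 2 : ℝ) : ℂ) =
      ∫ p : Eucl N × Eucl N, G ξ * conj (wave (p.1 - p.2) ξ) * (w p.1 * conj (w p.2))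
        ∂ν.prod ν := by
    intro ξ
    push_cast
    rw [← Complex.mul_conj']
    nth_rewrite 2 [waveTransform]
    rw [← integral_conj, waveTransform, ← integral_prod_mul, ← integral_const_mul]
    congr 1
    ext p
    simp only [wave_sub, map_mul, Complex.conj_conj]
    ring
  have hint := integrable_uncurry_wave_sub_mul hGi hww
  have h2 : ((∫ ξ : Eucl N, Real.exp (-b * ‖ξ‖ ^ 2) * ‖waveTransform ν w ξ‖ ^ 2 : ℝ) : ℂ) =
      ∫ p : Eucl N × Eucl N, (((Real.pi / b) ^ ((N : ℝ) / 2) * κ (p.1 - p.2) : ℝ) : ℂ) *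
        (w p.1 * conj (w p.2)) ∂ν.prod ν := by
    rw [← integral_complex_ofReal]
    simp only [Complex.ofReal_mul]
    have := integral_integral_swap hint
    simp only [← h1, integral_mul_const] at this
    rw [this]
    congr 1
    ext p
    rw [hG, integral_gaussian_mul_conj_wave hb, ← Complex.ofReal_mul]
  have hκp : Continuous fun p : Eucl N × Eucl N => κ (p.1 - p.2) := by fun_prop
  have hbdd : ∀ {f : Eucl N × Eucl N → ℝ} (C : ℝ), Continuous f → (∀ p, ‖f p‖ ≤ C) →
      Integrable f (ν.prod ν) := fun C hf hC =>
    .of_bound hf.aestronglyMeasurable C (Filter.Eventually.of_forall hC)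
  have hκn : ∀ z, ‖κ z‖ ≤ 1 := fun z => by
    rw [Real.norm_of_nonneg (Real.exp_nonneg _)]; exact hκ1 z
  have hi1 : Integrable (fun p : Eucl N × Eucl N => κ (p.1 - p.2) * ‖w p.1‖ ^ 2) (ν.prod ν) := by
    refine hbdd (1 * B ^ 2) (by fun_prop) fun p => ?_
    rw [norm_mul, norm_pow, norm_norm]
    gcongr
    exacts [hκn _, hwB _]
  have hi2 : Integrable (fun p : Eucl N × Eucl N => κ (p.1 - p.2) * ‖w p.2‖ ^ 2) (ν.prod ν) := by
    refine hbdd (1 * B ^ 2) (by fun_prop) fun p => ?_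
    rw [norm_mul, norm_pow, norm_norm]
    gcongr
    exacts [hκn _, hwB _]
  have h3 : ∫ p : Eucl N × Eucl N, κ (p.1 - p.2) * ‖w p.2‖ ^ 2 ∂ν.prod ν =
      ∫ p : Eucl N × Eucl N, κ (p.1 - p.2) * ‖w p.1‖ ^ 2 ∂ν.prod ν := by
    rw [← integral_prod_swap]
    congr 1
    ext p
    simp only [Prod.fst_swap, Prod.snd_swap, hκ, norm_sub_rev]
  have hwsq : Integrable (fun x => ‖w x‖ ^ 2) ν :=
    .of_bound (by fun_prop) (B ^ 2) (Filter.Eventually.of_forall fun x => by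
      rw [norm_pow, norm_norm]; gcongr; exact hwB x)
  have h4 : ∫ p : Eucl N × Eucl N, κ (p.1 - p.2) * ‖w p.1‖ ^ 2 ∂ν.prod ν ≤
      M * ∫ x, ‖w x‖ ^ 2 ∂ν := by
    rw [integral_prod _ hi1, ← integral_const_mul]
    refine integral_mono_ae hi1.integral_prod_left (hwsq.const_mul M) ?_
    filter_upwards [hM] with x hx
    simp only [integral_mul_const]
    gcongr
  set D : ℝ := (Real.pi / b) ^ ((N : ℝ) / 2) with hD
  have hD0 : 0 ≤ D := by positivity
  -- Schur's test for a symmetric kernel: use `|w(x)||w(y)| ≤ (|w(x)|² + |w(y)|²)/2`; the two halves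
  -- agree by `h3`.
  have h5 : ∫ ξ : Eucl N, Real.exp (-b * ‖ξ‖ ^ 2) * ‖waveTransform ν w ξ‖ ^ 2 ≤
      ∫ p : Eucl N × Eucl N, (D / 2) * (κ (p.1 - p.2) * ‖w p.1‖ ^ 2) +
        (D / 2) * (κ (p.1 - p.2) * ‖w p.2‖ ^ 2) ∂ν.prod ν := by
    refine (le_abs_self _).trans ?_
    rw [← Real.norm_eq_abs, ← Complex.norm_real, h2]
    refine norm_integral_le_of_norm_le ((hi1.const_mul _).add (hi2.const_mul _))
      (Filter.Eventually.of_forall fun p => ?_)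
    rw [norm_mul, norm_mul, RCLike.norm_conj, Complex.norm_real, Real.norm_of_nonneg (by
      have : 0 ≤ κ (p.1 - p.2) := Real.exp_nonneg _
      positivity)]
    have : 0 ≤ D * κ (p.1 - p.2) := mul_nonneg hD0 (Real.exp_nonneg _)
    nlinarith [mul_nonneg this (sq_nonneg (‖w p.1‖ - ‖w p.2‖))]
  rw [integral_add (hi1.const_mul _) (hi2.const_mul _), integral_const_mul, integral_const_mul,
    h3] at h5
  nlinarith [mul_le_mul_of_nonneg_left h4 hD0]

theorem integrable_wave_mul {g : Eucl N → ℂ} (hg : Integrable g) (x : Eucl N) :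
    Integrable fun ξ => wave x ξ * g ξ :=
  hg.bdd_mul (c := 1) (continuous_wave_right x).aestronglyMeasurable
    (Filter.Eventually.of_forall fun x => by simp)

/-- The inverse Fourier integral. -/
def synth (g : Eucl N → ℂ) (x : Eucl N) : ℂ := ∫ ξ, wave x ξ * g ξ

theorem continuous_synth {g : Eucl N → ℂ} (hg : Integrable g) : Continuous (synth g) :=
  continuous_of_dominated (bound := fun x => ‖g x‖)
    (fun x => (integrable_wave_mul hg x).aestronglyMeasurable)
    (fun x => Filter.Eventually.of_forall fun ξ => by simp) hg.norm
    (Filter.Eventually.of_forall fun ξ => (continuous_wave_left ξ).mul continuous_const)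

theorem norm_synth_le (g : Eucl N → ℂ) (x : Eucl N) : ‖synth g x‖ ≤ ∫ ξ, ‖g ξ‖ :=
  (norm_integral_le_integral_norm _).trans (by simp)

/-- Duality: `∫ |u|² dν` equals the pairing of `g` with the transform of `u ν`, and the `TT*`
estimate controls that transform. The factor `e` is the price of replacing the sharp cutoff by a
Gaussian, which is at least `e⁻¹` where `g ≠ 0`. -/
theorem integral_synth_sq_le {ν : Measure (Eucl N)} [IsFiniteMeasure ν] {g : Eucl N → ℂ}
    (hg : Integrable g) (hg2 : Integrable fun ξ => ‖g ξ‖ ^ 2) {b M : ℝ} (hb : 0 < b) (hM0 : 0 < M)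
    (hgs : ∀ ξ, g ξ ≠ 0 → b * ‖ξ‖ ^ 2 ≤ 1)
    (hM : ∀ᵐ x ∂ν, ∫ y, Real.exp (-(Real.pi ^ 2 / b) * ‖x - y‖ ^ 2) ∂ν ≤ M) :
    ∫ x, ‖synth g x‖ ^ 2 ∂ν ≤
      Real.exp 1 * ((Real.pi / b) ^ ((N : ℝ) / 2) * M) * ∫ ξ, ‖g ξ‖ ^ 2 := by
  set u := synth g with hu
  have huc : Continuous u := continuous_synth hg
  have hub := norm_synth_le g
  have hui : Integrable u ν := .of_bound huc.aestronglyMeasurable _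
    (Filter.Eventually.of_forall hub)
  set D : ℝ := (Real.pi / b) ^ ((N : ℝ) / 2) * M with hD
  have hD0 : 0 < D := by positivity
  have hJ := integral_gaussian_mul_waveTransform_sq_le huc hub hb hM
  have hJi := integrable_gaussian_mul_waveTransform_sq hui hb
  have hint : Integrable (Function.uncurry fun (x : Eucl N) (ξ : Eucl N) =>
      conj (u x) * (wave x ξ * g ξ)) (ν.prod volume) := by
    have h := hui.mul_prod hg
    refine h.mono ?_ (Filter.Eventually.of_forall fun q => ?_)
    · refine AEStronglyMeasurable.mul ?_ (AEStronglyMeasurable.mul ?_ ?_)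
      · exact (Complex.continuous_conj.comp (huc.comp continuous_fst)).aestronglyMeasurable
      · exact (continuous_wave continuous_fst continuous_snd).aestronglyMeasurable
      · exact hg.aestronglyMeasurable.comp_snd
    · simp [Function.uncurry]
  have h1 : ((∫ x, ‖u x‖ ^ 2 ∂ν : ℝ) : ℂ) = ∫ ξ, g ξ * conj (waveTransform ν u ξ) := by
    have h := integral_integral_swap hint
    rw [← integral_complex_ofReal]
    calc _ = ∫ x, (∫ ξ, conj (u x) * (wave x ξ * g ξ)) ∂ν := by
          congr 1
          ext x
          rw [integral_const_mul, ← synth, ← hu, Complex.conj_mul']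
          push_cast
          rfl
      _ = _ := by
          rw [h]
          congr 1
          ext ξ
          rw [waveTransform, ← integral_conj, ← integral_const_mul]
          congr 1
          ext x
          simp only [map_mul, Complex.conj_conj]
          ring
  set I := ∫ x, ‖u x‖ ^ 2 ∂ν with hI
  -- The weights in this arithmetic–geometric inequality are tuned so that the second term is at
  -- most `I / 2` by the `TT*` estimate and can be absorbed on the left.
  have h2 : I ≤ ∫ ξ, (Real.exp 1 * D / 2) * ‖g ξ‖ ^ 2 +
      1 / (2 * D) * (Real.exp (-b * ‖ξ‖ ^ 2) * ‖waveTransform ν u ξ‖ ^ 2) := by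
    refine (le_abs_self _).trans ?_
    rw [← Real.norm_eq_abs, ← Complex.norm_real, h1]
    refine norm_integral_le_of_norm_le ((hg2.const_mul _).add (hJi.const_mul _))
      (Filter.Eventually.of_forall fun ξ => ?_)
    rw [norm_mul, RCLike.norm_conj]
    by_cases h0 : g ξ = 0
    · simp only [h0, norm_zero, zero_mul, ne_eq, OfNat.ofNat_ne_zero, not_false_eq_true, zero_pow,
        mul_zero, zero_add]
      positivity
    · have h3 : Real.exp (-1) ≤ Real.exp (-b * ‖ξ‖ ^ 2) :=
        Real.exp_le_exp.2 (by have := hgs ξ h0; linarith)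
      have h4 : 1 / (2 * D) * (Real.exp (-1) * ‖waveTransform ν u ξ‖ ^ 2) ≤
          1 / (2 * D) * (Real.exp (-b * ‖ξ‖ ^ 2) * ‖waveTransform ν u ξ‖ ^ 2) := by gcongr
      refine le_trans ?_ (add_le_add_right h4 _)
      rw [Real.exp_neg]
      have he : 0 < Real.exp 1 := Real.exp_pos 1
      set p := ‖g ξ‖
      set q := ‖waveTransform ν u ξ‖
      have : Real.exp 1 * D / 2 * p ^ 2 + 1 / (2 * D) * ((Real.exp 1)⁻¹ * q ^ 2) - p * q =
          (Real.exp 1 * D * p - q) ^ 2 / (2 * D * Real.exp 1) := by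
        field_simp
        ring
      have h5 : 0 ≤ (Real.exp 1 * D * p - q) ^ 2 / (2 * D * Real.exp 1) := by positivity
      linarith
  rw [integral_add (hg2.const_mul _) (hJi.const_mul _), integral_const_mul,
    integral_const_mul] at h2
  have h6 : 1 / (2 * D) * ∫ ξ : Eucl N, Real.exp (-b * ‖ξ‖ ^ 2) * ‖waveTransform ν u ξ‖ ^ 2 ≤
      1 / (2 * D) * (D * I) := by gcongr
  have h7 : 1 / (2 * D) * (D * I) = I / 2 := by field_simp
  linarith

/-- The trace inequality of Agmon–Hörmander type: band-limited functions are square integrable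
with respect to Ahlfors measures. -/
theorem exists_lintegral_synth_sq_le (N : ℕ) (s : ℝ) : ∃ C : ℝ, 0 < C ∧
    ∀ (μ : Measure (Eucl N)) (A : ℝ), 0 < A → GlobalAhlfors μ s A → ∀ R : ℝ, 0 < R →
      ∀ g : Eucl N → ℂ, Integrable g → (Integrable fun ξ => ‖g ξ‖ ^ 2) →
        (∀ ξ, g ξ ≠ 0 → ‖ξ‖ ≤ R) →
        ∫⁻ x, ‖synth g x‖ₑ ^ 2 ∂μ ≤
          ENNReal.ofReal (C * A * R ^ ((N : ℝ) - s) * ∫ ξ, ‖g ξ‖ ^ 2) := by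
  obtain ⟨C, hC, hgauss⟩ := exists_lintegral_gaussian_le s (a := Real.pi ^ 2) (by positivity)
  refine ⟨Real.exp 1 * (Real.pi ^ ((N : ℝ) / 2) * C), by positivity,
    fun μ A hA hμ R hR g hg hg2 hgR => ?_⟩
  have := hμ.isLocallyFiniteMeasure
  set b : ℝ := (R ^ 2)⁻¹ with hb
  have hb0 : 0 < b := by positivity
  have hgs : ∀ ξ, g ξ ≠ 0 → b * ‖ξ‖ ^ 2 ≤ 1 := by
    intro ξ hξ
    rw [hb, inv_mul_le_iff₀ (by positivity), mul_one]
    have := hgR ξ hξ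
    gcongr
  have hM0 : 0 < C * A * R ^ (-s) := by positivity
  have hball : ∀ n : ℕ, ∫⁻ x in Metric.ball (0 : Eucl N) n, ‖synth g x‖ₑ ^ 2 ∂μ ≤
      ENNReal.ofReal (Real.exp 1 * (Real.pi ^ ((N : ℝ) / 2) * C) * A * R ^ ((N : ℝ) - s) *
        ∫ ξ, ‖g ξ‖ ^ 2) := by
    intro n
    -- Fubini above needs a finite measure. Restriction only lowers the Schur bound, which is
    -- uniform in `n`, so monotone convergence recovers `μ`.
    set ν := μ.restrict (Metric.ball (0 : Eucl N) n) with hν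
    have : IsFiniteMeasure ν := ⟨by
      rw [hν, Measure.restrict_apply_univ]; exact measure_ball_lt_top⟩
    have hM : ∀ᵐ x ∂ν, ∫ y, Real.exp (-(Real.pi ^ 2 / b) * ‖x - y‖ ^ 2) ∂ν ≤
        C * A * R ^ (-s) := by
      filter_upwards [ae_restrict_of_ae μ.support_mem_ae] with x hx
      have h := (lintegral_mono' (Measure.restrict_le_self (s := Metric.ball (0 : Eucl N) n))
        (le_refl _)).trans (hgauss μ A hA hμ x hx R hR)
      rw [integral_eq_lintegral_of_nonneg_ae (Filter.Eventually.of_forall fun y => by positivity)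
        (by fun_prop)]
      refine ENNReal.toReal_le_of_le_ofReal hM0.le ?_
      refine le_trans (le_of_eq ?_) h
      congr 1
      ext y
      congr 2
      rw [hb]
      field_simp
    have h := integral_synth_sq_le (ν := ν) hg hg2 hb0 hM0 hgs hM
    have hi : Integrable (fun x => ‖synth g x‖ ^ 2) ν :=
      .of_bound ((continuous_synth hg).norm.pow 2).aestronglyMeasurable ((∫ ξ, ‖g ξ‖) ^ 2)
        (Filter.Eventually.of_forall fun x => by
          rw [norm_pow, norm_norm]; gcongr; exact norm_synth_le g x)
    have h2 : ∫⁻ x, ‖synth g x‖ₑ ^ 2 ∂ν = ENNReal.ofReal (∫ x, ‖synth g x‖ ^ 2 ∂ν) := by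
      rw [ofReal_integral_eq_lintegral_ofReal hi
        (Filter.Eventually.of_forall fun x => by positivity)]
      simp only [← ofReal_norm, ENNReal.ofReal_pow (norm_nonneg _)]
    rw [h2]
    refine ENNReal.ofReal_le_ofReal (h.trans (le_of_eq ?_))
    have h3 : (Real.pi / b) ^ ((N : ℝ) / 2) = Real.pi ^ ((N : ℝ) / 2) * R ^ (N : ℝ) := by
      rw [hb, div_inv_eq_mul, Real.mul_rpow (by positivity) (by positivity),
        ← Real.rpow_natCast R 2, ← Real.rpow_mul hR.le]
      congr 2
      push_cast
      ring
    rw [h3, sub_eq_add_neg, Real.rpow_add hR]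
    ring
  have hU : ∫⁻ x, ‖synth g x‖ₑ ^ 2 ∂μ =
      ⨆ n : ℕ, ∫⁻ x in Metric.ball (0 : Eucl N) n, ‖synth g x‖ₑ ^ 2 ∂μ := by
    rw [← setLIntegral_iUnion_of_directed _ (Monotone.directed_le fun m n hmn =>
      Metric.ball_subset_ball (by exact_mod_cast hmn)), Metric.iUnion_ball_nat,
      setLIntegral_univ]
  rw [hU]
  exact iSup_le hball

end Trace

end BirmanSchwinger

end

/-! ### Frequency bands of a test function: dyadic square function and low-frequency bound. -/

noncomputable section

namespace BirmanSchwinger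

theorem lintegral_mul_sq_le {α : Type*} [MeasurableSpace α] (μ : Measure α) {f g : α → ℝ≥0∞}
    (hf : AEMeasurable f μ) (hg : AEMeasurable g μ) :
    (∫⁻ a, f a * g a ∂μ) ^ 2 ≤ (∫⁻ a, f a ^ 2 ∂μ) * ∫⁻ a, g a ^ 2 ∂μ := by
  have h := ENNReal.lintegral_mul_le_Lp_mul_Lq μ (p := 2) (q := 2) ⟨by norm_num, by norm_num,
    by norm_num⟩ hf hg
  simp only [Pi.mul_apply, ENNReal.rpow_ofNat] at h
  calc _ ≤ ((∫⁻ a, f a ^ 2 ∂μ) ^ (1 / 2 : ℝ) * (∫⁻ a, g a ^ 2 ∂μ) ^ (1 / 2 : ℝ)) ^ 2 := by gcongr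
    _ = _ := by
      rw [mul_pow, ← ENNReal.rpow_natCast, ← ENNReal.rpow_mul, ← ENNReal.rpow_natCast,
        ← ENNReal.rpow_mul]
      norm_num

theorem tsum_mul_sq_le (f g : ℕ → ℝ≥0∞) :
    (∑' d, f d * g d) ^ 2 ≤ (∑' d, f d ^ 2) * ∑' d, g d ^ 2 := by
  simpa only [lintegral_count] using lintegral_mul_sq_le Measure.count (f := f) (g := g)
    (measurable_of_countable _).aemeasurable (measurable_of_countable _).aemeasurable

section Bands

variable {N : ℕ} {l : ℝ≥0}

theorem HomTest.continuous_fourier (v : HomTest N l) : Continuous (𝓕 v.fn) := by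
  rw [v.fourier_eq]; exact SchwartzMap.continuous _

theorem HomTest.integrable_fourier (v : HomTest N l) : Integrable (𝓕 v.fn) := by
  rw [v.fourier_eq]; exact (𝓕 v.toSchwartz : SchwartzMap (Eucl N) ℂ).integrable

theorem HomTest.integrable_fourier_sq (v : HomTest N l) :
    Integrable fun ξ => ‖𝓕 v.fn ξ‖ ^ 2 := by
  rw [v.fourier_eq]
  exact (memLp_two_iff_integrable_sq_norm
    (𝓕 v.toSchwartz : SchwartzMap (Eucl N) ℂ).continuous.aestronglyMeasurable).1
    ((𝓕 v.toSchwartz : SchwartzMap (Eucl N) ℂ).memLp 2)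

/-- The density of the squared homogeneous Sobolev norm. -/
def HomTest.density (v : HomTest N l) (ξ : Eucl N) : ℝ :=
  (2 * Real.pi * ‖ξ‖) ^ (2 * (l : ℝ)) * ‖𝓕 v.fn ξ‖ ^ 2

theorem HomTest.density_nonneg (v : HomTest N l) (ξ : Eucl N) : 0 ≤ v.density ξ := by
  unfold HomTest.density; positivity

theorem HomTest.ofReal_density (v : HomTest N l) (ξ : Eucl N) :
    (((2 * Real.pi * ‖ξ‖) ^ (2 * (l : ℝ)) : ℝ) : ℂ) * (conj (𝓕 v.fn ξ) * 𝓕 v.fn ξ) =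
      (v.density ξ : ℂ) := by
  rw [Complex.conj_mul', HomTest.density]
  push_cast
  rfl

theorem HomTest.integrable_density (v : HomTest N l) : Integrable v.density := by
  have h := homInner_integrable v v
  simp only [v.ofReal_density] at h
  exact h.re

theorem HomTest.norm_sq (v : HomTest N l) : ‖v‖ ^ 2 = ∫ ξ, v.density ξ := by
  rw [← inner_self_eq_norm_sq (𝕜 := ℂ)]
  change (homInner v v).re = _
  simp only [homInner, v.ofReal_density]
  rw [integral_complex_ofReal, Complex.ofReal_re]

theorem HomTest.lintegral_density (v : HomTest N l) :
    ∫⁻ ξ, ENNReal.ofReal (v.density ξ) = ENNReal.ofReal (‖v‖ ^ 2) := by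
  rw [v.norm_sq, ofReal_integral_eq_lintegral_ofReal v.integrable_density
    (Filter.Eventually.of_forall v.density_nonneg)]

theorem HomTest.fn_eq_synth (v : HomTest N l) (x : Eucl N) : v.fn x = synth (𝓕 v.fn) x := by
  have h := Continuous.fourierInv_fourier_eq v.contDiff.continuous v.integrable_fn
    v.integrable_fourier
  conv_lhs => rw [← h]
  rw [Real.fourierInv_eq, synth]
  congr 1
  ext ξ
  rw [wave, real_inner_comm, Circle.smul_def, smul_eq_mul]

/-- The part of a test function with frequencies in `E`. -/
def HomTest.band (v : HomTest N l) (E : Set (Eucl N)) (x : Eucl N) : ℂ :=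
  synth (E.indicator (𝓕 v.fn)) x

theorem HomTest.band_eq (v : HomTest N l) {E : Set (Eucl N)} (hE : MeasurableSet E) (x : Eucl N) :
    v.band E x = ∫ ξ in E, wave x ξ * 𝓕 v.fn ξ := by
  rw [HomTest.band, synth, ← integral_indicator hE]
  congr 1
  ext ξ
  by_cases h : ξ ∈ E <;> simp [h]

theorem HomTest.band_add (v w : HomTest N l) {E : Set (Eucl N)} (hE : MeasurableSet E)
    (x : Eucl N) : (v + w).band E x = v.band E x + w.band E x := by
  rw [HomTest.band_eq _ hE, HomTest.band_eq _ hE, HomTest.band_eq _ hE, ← integral_add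
    (integrable_wave_mul v.integrable_fourier x).integrableOn
    (integrable_wave_mul w.integrable_fourier x).integrableOn]
  congr 1
  ext ξ
  rw [HomTest.fourier_add, mul_add]

theorem HomTest.band_smul (c : ℂ) (v : HomTest N l) {E : Set (Eucl N)} (hE : MeasurableSet E)
    (x : Eucl N) : (c • v).band E x = c * v.band E x := by
  rw [HomTest.band_eq _ hE, HomTest.band_eq _ hE, ← integral_const_mul]
  congr 1
  ext ξ
  rw [HomTest.fourier_smul]
  ring

theorem HomTest.fn_eq_band_add_band_compl (v : HomTest N l) {E : Set (Eucl N)}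
    (hE : MeasurableSet E) (x : Eucl N) : v.fn x = v.band E x + v.band Eᶜ x := by
  rw [v.band_eq hE, v.band_eq hE.compl,
    integral_add_compl hE (integrable_wave_mul v.integrable_fourier x), v.fn_eq_synth, synth]

theorem HomTest.continuous_band (v : HomTest N l) {E : Set (Eucl N)} (hE : MeasurableSet E) :
    Continuous (v.band E) :=
  continuous_synth (v.integrable_fourier.indicator hE)

/-- The dyadic frequency annulus `2^k ≤ |ξ| < 2^{k+1}`. -/
def annulus (N : ℕ) (k : ℤ) : Set (Eucl N) :=
  norm ⁻¹' Set.Ico ((2 : ℝ) ^ k) ((2 : ℝ) ^ (k + 1))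

theorem measurableSet_annulus (k : ℤ) : MeasurableSet (annulus N k) :=
  measurable_norm measurableSet_Ico

theorem pairwise_disjoint_annulus : Pairwise (Function.onFun Disjoint (annulus N)) := by
  have h := (zpow_right_mono₀ (one_le_two : (1 : ℝ) ≤ 2)).pairwise_disjoint_on_Ico_succ
  intro i j hij
  exact (h hij).preimage _

theorem iUnion_annulus_add (m : ℤ) :
    ⋃ d : ℕ, annulus N (m + d) = (Metric.ball (0 : Eucl N) ((2 : ℝ) ^ m))ᶜ := by
  ext ξ
  simp only [Set.mem_iUnion, Set.mem_compl_iff, mem_ball_zero_iff, not_lt, annulus,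
    Set.mem_preimage, Set.mem_Ico]
  constructor
  · rintro ⟨d, hd, -⟩
    exact (zpow_le_zpow_right₀ one_le_two (by omega)).trans hd
  · intro h
    have hpos : 0 < ‖ξ‖ := lt_of_lt_of_le (by positivity) h
    obtain ⟨k, hk1, hk2⟩ := exists_mem_Ico_zpow hpos (one_lt_two : (1 : ℝ) < 2)
    have hmk : m < k + 1 := (zpow_lt_zpow_iff_right₀ (one_lt_two : (1 : ℝ) < 2)).1 (h.trans_lt hk2)
    refine ⟨(k - m).toNat, ?_⟩
    have : m + ((k - m).toNat : ℤ) = k := by omega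
    rw [this]
    exact ⟨hk1, hk2⟩

/-- The square function of the dyadic decomposition, with weights `2^{kβ}`. -/
def HomTest.squareFn (v : HomTest N l) (β : ℝ) (x : Eucl N) : ℝ≥0∞ :=
  ∑' k : ℤ, ENNReal.ofReal (((2 : ℝ) ^ k) ^ β) * ‖v.band (annulus N k) x‖ₑ ^ 2

theorem HomTest.measurable_squareFn (v : HomTest N l) (β : ℝ) : Measurable (v.squareFn β) :=
  Measurable.tsum fun k => (((v.continuous_band
    (measurableSet_annulus k)).measurable.enorm).pow_const 2).const_mul _

theorem two_zpow_add_rpow (m : ℤ) (d : ℕ) (β : ℝ) :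
    ((2 : ℝ) ^ (m + d)) ^ β = ((2 : ℝ) ^ m) ^ β * ((2 : ℝ) ^ β) ^ d := by
  rw [zpow_add₀ two_ne_zero, Real.mul_rpow (by positivity) (by positivity), zpow_natCast,
    Real.rpow_pow_comm zero_le_two]

/-- High frequencies are controlled pointwise by the square function. -/
theorem HomTest.enorm_band_compl_ball_sq_le (v : HomTest N l) {β : ℝ} (hβ : 0 < β) (m : ℤ)
    (x : Eucl N) : ‖v.band (Metric.ball 0 ((2 : ℝ) ^ m))ᶜ x‖ₑ ^ 2 ≤
      ENNReal.ofReal ((1 - 2 ^ (-β))⁻¹ * ((2 : ℝ) ^ m) ^ (-β)) * v.squareFn β x := by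
  have hr0 : (0 : ℝ) ≤ 2 ^ (-β) := by positivity
  have hr1 : (2 : ℝ) ^ (-β) < 1 := Real.rpow_lt_one_of_one_lt_of_neg one_lt_two (by linarith)
  have hsum : HasSum (fun d : ℕ => v.band (annulus N (m + d)) x)
      (v.band (Metric.ball 0 ((2 : ℝ) ^ m))ᶜ x) := by
    have h := hasSum_integral_iUnion (μ := volume) (f := fun ξ => wave x ξ * 𝓕 v.fn ξ)
      (s := fun d : ℕ => annulus N (m + d)) (fun d => measurableSet_annulus _)
      (fun i j hij => pairwise_disjoint_annulus (by simpa using hij))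
      (integrable_wave_mul v.integrable_fourier x).integrableOn
    rw [iUnion_annulus_add] at h
    rw [v.band_eq measurableSet_ball.compl]
    simpa only [v.band_eq (measurableSet_annulus _)] using h
  -- Reciprocal weights for Cauchy–Schwarz: the squares of `a` form a convergent geometric series,
  -- those of `c` are the weights of the square function.
  set a : ℕ → ℝ := fun d => ((2 : ℝ) ^ (m + d)) ^ (-β / 2) with ha
  set c : ℕ → ℝ := fun d => ((2 : ℝ) ^ (m + d)) ^ (β / 2) with hc
  have hac : ∀ d, a d * c d = 1 := fun d => by
    simp only [ha, hc]
    rw [← Real.rpow_add (by positivity)]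
    ring_nf
    exact Real.rpow_zero _
  have ha2 : ∀ d, a d ^ 2 = ((2 : ℝ) ^ m) ^ (-β) * ((2 : ℝ) ^ (-β)) ^ d := fun d => by
    rw [← two_zpow_add_rpow, ← Real.rpow_natCast, ← Real.rpow_mul (by positivity)]
    congr 1
    push_cast
    ring
  have hc2 : ∀ d, c d ^ 2 = ((2 : ℝ) ^ (m + d)) ^ β := fun d => by
    rw [← Real.rpow_natCast, ← Real.rpow_mul (by positivity)]
    congr 1
    push_cast
    ring
  have ha0 : ∀ d, 0 ≤ a d := fun d => by positivity
  have hc0 : ∀ d, 0 ≤ c d := fun d => by positivity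
  rw [← hsum.tsum_eq]
  calc _ ≤ (∑' d : ℕ, ‖v.band (annulus N (m + d)) x‖ₑ) ^ 2 := by
        gcongr; exact enorm_tsum_le_tsum_enorm
    _ = (∑' d : ℕ, ENNReal.ofReal (a d) *
          (ENNReal.ofReal (c d) * ‖v.band (annulus N (m + d)) x‖ₑ)) ^ 2 := by
        congr 2
        ext d
        rw [← mul_assoc, ← ENNReal.ofReal_mul (ha0 d), hac d, ENNReal.ofReal_one, one_mul]
    _ ≤ _ := tsum_mul_sq_le _ _
    _ ≤ _ := by
        refine mul_le_mul' (le_of_eq ?_) ?_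
        · simp only [← ENNReal.ofReal_pow (ha0 _), ha2]
          rw [← ENNReal.ofReal_tsum_of_nonneg (fun d => by positivity)
            ((summable_geometric_of_lt_one hr0 hr1).mul_left _), tsum_mul_left,
            tsum_geometric_of_lt_one hr0 hr1, mul_comm]
        · simp only [mul_pow, ← ENNReal.ofReal_pow (hc0 _), hc2]
          exact ENNReal.tsum_comp_le_tsum_of_injective
            (f := fun d : ℕ => m + (d : ℤ)) (fun i j hij => by simpa using hij)
            (fun k : ℤ => ENNReal.ofReal (((2 : ℝ) ^ k) ^ β) * ‖v.band (annulus N k) x‖ₑ ^ 2)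

/-- On the annulus `|ξ| ≈ 2^k` the trace inequality contributes `A 2^{k(N-s)}` and passing to the
Sobolev density contributes `2^{-2lk}`. The weight `2^{k(2l-N+s)}` cancels both exactly, so the
disjoint annuli sum to the full norm. -/
theorem exists_lintegral_squareFn_le (N : ℕ) (l : ℝ≥0) (s : ℝ) : ∃ C : ℝ, 0 < C ∧
    ∀ (μ : Measure (Eucl N)) (A : ℝ), 0 < A → GlobalAhlfors μ s A → ∀ v : HomTest N l,
      ∫⁻ x, v.squareFn (2 * l - N + s) x ∂μ ≤ ENNReal.ofReal (C * A * ‖v‖ ^ 2) := by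
  obtain ⟨C, hC, htrace⟩ := exists_lintegral_synth_sq_le N s
  set C' : ℝ := C * 2 ^ ((N : ℝ) - s) * (2 * Real.pi) ^ (-(2 * (l : ℝ))) with hC'
  refine ⟨C', by positivity, fun μ A hA hμ v => ?_⟩
  have hk : ∀ k : ℤ, ∫⁻ x, ENNReal.ofReal (((2 : ℝ) ^ k) ^ (2 * l - N + s)) *
      ‖v.band (annulus N k) x‖ₑ ^ 2 ∂μ ≤
      ENNReal.ofReal (C' * A) * ∫⁻ ξ in annulus N k, ENNReal.ofReal (v.density ξ) := by
    intro k
    have hm := measurableSet_annulus (N := N) k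
    set R : ℝ := (2 : ℝ) ^ k with hR
    have hR0 : 0 < R := by positivity
    have hind : (fun ξ => ‖(annulus N k).indicator (𝓕 v.fn) ξ‖ ^ 2) =
        (annulus N k).indicator fun ξ => ‖𝓕 v.fn ξ‖ ^ 2 := by
      ext ξ
      by_cases h : ξ ∈ annulus N k <;> simp [h]
    -- The trace inequality uses the outer radius, the density bound the inner one; the mismatch is
    -- the factor `2^{N-s}` in `C'`.
    have h1 := htrace μ A hA hμ (2 ^ (k + 1)) (by positivity) ((annulus N k).indicator (𝓕 v.fn))
      (v.integrable_fourier.indicator hm)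
      (by rw [hind]; exact v.integrable_fourier_sq.indicator hm)
      (fun ξ hξ => (Set.mem_of_indicator_ne_zero hξ).2.le)
    rw [hind, integral_indicator hm] at h1
    have h2 : ∫ ξ in annulus N k, ‖𝓕 v.fn ξ‖ ^ 2 ≤
        ∫ ξ in annulus N k, (2 * Real.pi * R) ^ (-(2 * (l : ℝ))) * v.density ξ := by
      refine setIntegral_mono_on v.integrable_fourier_sq.integrableOn
        (v.integrable_density.integrableOn.const_mul _) hm fun ξ hξ => ?_
      have h3 : 2 * Real.pi * R ≤ 2 * Real.pi * ‖ξ‖ := by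
        have := hξ.1
        gcongr
      have h4 : (2 * Real.pi * R) ^ (2 * (l : ℝ)) ≤ (2 * Real.pi * ‖ξ‖) ^ (2 * (l : ℝ)) :=
        Real.rpow_le_rpow (by positivity) h3 (by positivity)
      rw [HomTest.density, ← mul_assoc, Real.rpow_neg (by positivity)]
      refine le_mul_of_one_le_left (by positivity) ?_
      rw [inv_mul_eq_div, one_le_div (by positivity)]
      exact h4
    rw [integral_const_mul] at h2
    rw [lintegral_const_mul' _ _ ENNReal.ofReal_ne_top]
    calc _ ≤ ENNReal.ofReal (R ^ (2 * l - N + s)) * ENNReal.ofReal (C * A * (2 ^ (k + 1)) ^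
          ((N : ℝ) - s) * ((2 * Real.pi * R) ^ (-(2 * (l : ℝ))) *
            ∫ ξ in annulus N k, v.density ξ)) := by
          refine mul_le_mul_right (h1.trans (ENNReal.ofReal_le_ofReal ?_)) _
          gcongr
      _ = ENNReal.ofReal (C' * A * ∫ ξ in annulus N k, v.density ξ) := by
          rw [← ENNReal.ofReal_mul (by positivity)]
          congr 1
          have e1 : ((2 : ℝ) ^ (k + 1)) ^ ((N : ℝ) - s) = R ^ ((N : ℝ) - s) * 2 ^ ((N : ℝ) - s) := by
            rw [zpow_add_one₀ two_ne_zero, Real.mul_rpow (by positivity) (by positivity)]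
          have e2 : (2 * Real.pi * R) ^ (-(2 * (l : ℝ))) =
              (2 * Real.pi) ^ (-(2 * (l : ℝ))) * R ^ (-(2 * (l : ℝ))) := by
            rw [Real.mul_rpow (by positivity) (by positivity)]
          have e3 : R ^ (2 * l - N + s) * R ^ ((N : ℝ) - s) * R ^ (-(2 * (l : ℝ))) = 1 := by
            rw [← Real.rpow_add hR0, ← Real.rpow_add hR0]
            ring_nf
            exact Real.rpow_zero _
          rw [e1, e2, hC']
          linear_combination (C * A * 2 ^ ((N : ℝ) - s) * (2 * Real.pi) ^ (-(2 * (l : ℝ))) *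
            ∫ ξ in annulus N k, v.density ξ) * e3
      _ = _ := by
          rw [ENNReal.ofReal_mul (by positivity), ofReal_integral_eq_lintegral_ofReal
            v.integrable_density.integrableOn (Filter.Eventually.of_forall v.density_nonneg)]
  unfold HomTest.squareFn
  rw [lintegral_tsum fun k => ((((v.continuous_band
    (measurableSet_annulus k)).measurable.enorm).pow_const 2).const_mul _).aemeasurable]
  calc _ ≤ ∑' k : ℤ, ENNReal.ofReal (C' * A) *
        ∫⁻ ξ in annulus N k, ENNReal.ofReal (v.density ξ) := ENNReal.tsum_le_tsum hk
    _ = ENNReal.ofReal (C' * A) * ∫⁻ ξ in ⋃ k, annulus N k, ENNReal.ofReal (v.density ξ) := by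
        rw [ENNReal.tsum_mul_left, lintegral_iUnion (fun k => measurableSet_annulus k)
          pairwise_disjoint_annulus]
    _ ≤ ENNReal.ofReal (C' * A) * ENNReal.ofReal (‖v‖ ^ 2) := by
        rw [← v.lintegral_density]
        exact mul_le_mul_right (setLIntegral_le_lintegral _ _) _
    _ = _ := by rw [← ENNReal.ofReal_mul (by positivity)]

/-- Local integrability from `a < N`, then scaling to the unit ball. The `+ 1` in the constant only
secures positivity. -/
theorem exists_setLIntegral_ball_rpow_le {N : ℕ} {a : ℝ} (ha0 : 0 < a) (haN : a < N) :
    ∃ C : ℝ, 0 < C ∧ ∀ R : ℝ, 0 < R →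
      ∫⁻ ξ in Metric.ball (0 : Eucl N) R, ENNReal.ofReal (‖ξ‖ ^ (-a)) ≤
        ENNReal.ofReal (C * R ^ ((N : ℝ) - a)) := by
  have hN : 1 ≤ Module.finrank ℝ (Eucl N) := by
    rw [finrank_euclideanSpace_fin]
    have : (0 : ℝ) < N := ha0.trans haN
    exact_mod_cast this
  have hint : ∀ r : ℝ, IntegrableOn (fun ξ : Eucl N => ‖ξ‖ ^ (-a)) (Metric.ball 0 r) := fun r =>
    integrableOn_ball_of_norm_le_rpow hN (C := 1) (α := a) (by simpa using haN)
      (Filter.Eventually.of_forall fun ξ => by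
        rw [one_mul, Real.norm_of_nonneg (by positivity)])
      (measurable_norm.pow_const _).aestronglyMeasurable
  refine ⟨(∫ ξ in Metric.ball (0 : Eucl N) 1, ‖ξ‖ ^ (-a)) + 1, ?_, fun R hR => ?_⟩
  · have : 0 ≤ ∫ ξ in Metric.ball (0 : Eucl N) 1, ‖ξ‖ ^ (-a) :=
      integral_nonneg fun ξ => by positivity
    linarith
  · rw [← ofReal_integral_eq_lintegral_ofReal (hint R)
      (Filter.Eventually.of_forall fun ξ => by positivity)]
    refine ENNReal.ofReal_le_ofReal ?_
    have h := Measure.setIntegral_comp_smul_of_pos (volume : Measure (Eucl N))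
      (fun ξ : Eucl N => ‖ξ‖ ^ (-a)) (Metric.ball 0 1) hR
    rw [smul_unitBall_of_pos hR, finrank_euclideanSpace_fin, smul_eq_mul] at h
    have h2 : ∀ ξ : Eucl N, ‖R • ξ‖ ^ (-a) = R ^ (-a) * ‖ξ‖ ^ (-a) := fun ξ => by
      rw [norm_smul, Real.norm_of_nonneg hR.le, Real.mul_rpow hR.le (norm_nonneg _)]
    simp only [h2, integral_const_mul] at h
    have h3 : ∫ ξ in Metric.ball (0 : Eucl N) R, ‖ξ‖ ^ (-a) =
        (∫ ξ in Metric.ball (0 : Eucl N) 1, ‖ξ‖ ^ (-a)) * R ^ ((N : ℝ) - a) := by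
      rw [sub_eq_add_neg, Real.rpow_add hR, Real.rpow_natCast]
      have : (R ^ N : ℝ) ≠ 0 := by positivity
      field_simp at h
      linarith
    rw [h3]
    have : 0 ≤ R ^ ((N : ℝ) - a) := by positivity
    nlinarith

/-- Low frequencies are controlled pointwise by the homogeneous Sobolev norm. -/
theorem exists_norm_band_ball_sq_le {N : ℕ} {l : ℝ≥0} (hl : 0 < l) (hlN : 2 * (l : ℝ) < N) :
    ∃ C : ℝ, 0 < C ∧ ∀ (v : HomTest N l) (R : ℝ), 0 < R → ∀ x : Eucl N,
      ‖v.band (Metric.ball 0 R) x‖ ^ 2 ≤ C * R ^ ((N : ℝ) - 2 * l) * ‖v‖ ^ 2 := by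
  have hl' : (0 : ℝ) < l := by exact_mod_cast hl
  have : Nontrivial (Eucl N) := by
    apply Module.nontrivial_of_finrank_pos (R := ℝ)
    rw [finrank_euclideanSpace_fin]
    have : (0 : ℝ) < N := by linarith
    exact_mod_cast this
  obtain ⟨C, hC, hball⟩ := exists_setLIntegral_ball_rpow_le (N := N) (a := 2 * l) (by positivity) hlN
  refine ⟨(2 * Real.pi) ^ (-(2 * (l : ℝ))) * C, by positivity, fun v R hR x => ?_⟩
  set f : Eucl N → ℝ := fun ξ => (2 * Real.pi * ‖ξ‖) ^ (-(l : ℝ)) with hf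
  set g : Eucl N → ℝ := fun ξ => (2 * Real.pi * ‖ξ‖) ^ (l : ℝ) * ‖𝓕 v.fn ξ‖ with hg
  have hf0 : ∀ ξ, 0 ≤ f ξ := fun ξ => by positivity
  have hg0 : ∀ ξ, 0 ≤ g ξ := fun ξ => by positivity
  have hf2 : ∀ ξ, f ξ ^ 2 = (2 * Real.pi) ^ (-(2 * (l : ℝ))) * ‖ξ‖ ^ (-(2 * (l : ℝ))) := fun ξ => by
    rw [← Real.mul_rpow (by positivity) (by positivity), ← Real.rpow_natCast,
      ← Real.rpow_mul (by positivity)]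
    congr 1
    push_cast
    ring
  have hg2 : ∀ ξ, g ξ ^ 2 = v.density ξ := fun ξ => by
    simp only [hg]
    rw [mul_pow, HomTest.density, ← Real.rpow_natCast, ← Real.rpow_mul (by positivity)]
    congr 2
    push_cast
    ring
  have hmf : AEMeasurable (fun ξ => ENNReal.ofReal (f ξ)) (volume.restrict (Metric.ball 0 R)) := by
    simp only [hf]
    fun_prop
  have hmg : AEMeasurable (fun ξ => ENNReal.ofReal (g ξ)) (volume.restrict (Metric.ball 0 R)) := by
    have := v.continuous_fourier.measurable
    simp only [hg]
    fun_prop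
  have h1 : ‖v.band (Metric.ball 0 R) x‖ₑ ≤
      ∫⁻ ξ in Metric.ball 0 R, ENNReal.ofReal (f ξ) * ENNReal.ofReal (g ξ) := by
    rw [v.band_eq measurableSet_ball]
    refine (enorm_integral_le_lintegral_enorm _).trans (le_of_eq (lintegral_congr_ae ?_))
    filter_upwards [ae_restrict_of_ae (compl_mem_ae_iff.2
      (measure_singleton (μ := (volume : Measure (Eucl N))) 0))] with ξ hξ
    have hξ0 : 0 < ‖ξ‖ := norm_pos_iff.2 hξ
    rw [← ENNReal.ofReal_mul (hf0 ξ), ← ofReal_norm, norm_mul, norm_wave, one_mul]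
    congr 1
    simp only [hf, hg]
    rw [← mul_assoc, ← Real.rpow_add (by positivity), neg_add_cancel, Real.rpow_zero, one_mul]
  -- Cauchy–Schwarz between `|ξ|^{-l}`, square integrable near the origin because `2l < N`, and
  -- `|ξ|^l |v̂|`.
  have h2 := (pow_le_pow_left' h1 2).trans (lintegral_mul_sq_le _ hmf hmg)
  simp only [← ENNReal.ofReal_pow (hf0 _), ← ENNReal.ofReal_pow (hg0 _), hf2, hg2,
    ENNReal.ofReal_mul (Real.rpow_nonneg Real.two_pi_pos.le (-(2 * (l : ℝ))))] at h2
  rw [lintegral_const_mul' _ _ ENNReal.ofReal_ne_top] at h2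
  have h3 : ‖v.band (Metric.ball 0 R) x‖ₑ ^ 2 ≤ ENNReal.ofReal
      ((2 * Real.pi) ^ (-(2 * (l : ℝ))) * C * R ^ ((N : ℝ) - 2 * l) * ‖v‖ ^ 2) := by
    refine h2.trans ?_
    rw [mul_assoc _ C, ENNReal.ofReal_mul (by positivity), ENNReal.ofReal_mul (by positivity)]
    refine mul_le_mul' (mul_le_mul_right (hball R hR) _) ?_
    rw [← v.lintegral_density]
    exact setLIntegral_le_lintegral _ _
  rw [← ofReal_norm, ← ENNReal.ofReal_pow (norm_nonneg _)] at h3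
  exact (ENNReal.ofReal_le_ofReal_iff (by positivity)).1 h3

end Bands

end BirmanSchwinger

end

noncomputable section

namespace BirmanSchwinger

/-! ### The point-dependent frequency cutoff. -/

section Splitting

variable {N : ℕ} {l : ℝ≥0}

theorem denseRange_toSobolev :
    DenseRange (HomTest.toSobolev : HomTest N l → HomSobolev N l) :=
  UniformSpace.Completion.denseRange_coe

theorem HomTest.norm_toSobolev (v : HomTest N l) : ‖v.toSobolev‖ = ‖v‖ :=
  UniformSpace.Completion.norm_coe v

/-- A bounded linear map on test functions extends to the Sobolev space. -/
theorem exists_extension {F : Type*} [NormedAddCommGroup F] [NormedSpace ℂ F] [CompleteSpace F]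
    (φ : HomTest N l →ₗ[ℂ] F) {C : ℝ} (hC : 0 ≤ C) (h : ∀ v, ‖φ v‖ ≤ C * ‖v‖) :
    ∃ T : HomSobolev N l →L[ℂ] F, (∀ v, T v.toSobolev = φ v) ∧ ‖T‖ ≤ C := by
  let e : HomTest N l →L[ℂ] HomSobolev N l := UniformSpace.Completion.toComplL
  have he : DenseRange (e : HomTest N l →ₗ[ℂ] HomSobolev N l) := denseRange_toSobolev
  have hnorm : ∀ v, ‖φ v‖ ≤ C * ‖(e : HomTest N l →ₗ[ℂ] HomSobolev N l) v‖ := fun v => by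
    refine (h v).trans (le_of_eq ?_)
    rw [← v.norm_toSobolev]
    rfl
  exact ⟨φ.extendOfNorm (e : HomTest N l →ₗ[ℂ] HomSobolev N l),
    LinearMap.extendOfNorm_eq he ⟨C, hnorm⟩, LinearMap.opNorm_extendOfNorm_le he hC hnorm⟩

/-- Balances the two halves of the splitting, with `w = |f(x)|²`: the ideal cutoff `ρ` solves `w
ρ^{-β} = t / A`. Rounding up to a power of two keeps the high-frequency bound and costs `2^b` in the
low-frequency one. -/
theorem exists_scale {b β θ A t : ℝ} (hb : 0 < b) (hβ : 0 < β) (hθ : θ - 1 = b / β) (hA : 0 < A)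
    (ht : 0 < t) {w : ℝ} (hw : 0 ≤ w) : ∃ m : ℤ,
      w * ((2 : ℝ) ^ m) ^ b ≤ 2 ^ b * (A / t) ^ (θ - 1) * w ^ θ ∧
      w * ((2 : ℝ) ^ m) ^ (-β) ≤ t / A := by
  rcases hw.eq_or_lt with rfl | hw
  · refine ⟨0, ?_, ?_⟩
    · rw [zero_mul]; positivity
    · rw [zero_mul]; positivity
  set ρ : ℝ := (A / t * w) ^ (1 / β) with hρ
  have hρ0 : 0 < ρ := by positivity
  obtain ⟨n, hn1, hn2⟩ := exists_mem_Ico_zpow hρ0 (one_lt_two : (1 : ℝ) < 2)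
  refine ⟨n + 1, ?_, ?_⟩
  · have h1 : ((2 : ℝ) ^ (n + 1)) ^ b ≤ (2 * ρ) ^ b := by
      refine Real.rpow_le_rpow (by positivity) ?_ hb.le
      rw [zpow_add_one₀ two_ne_zero]
      linarith
    have h2 : (2 * ρ) ^ b = 2 ^ b * ((A / t) ^ (θ - 1) * w ^ (θ - 1)) := by
      rw [Real.mul_rpow zero_le_two hρ0.le, hρ, ← Real.rpow_mul (by positivity), hθ,
        Real.mul_rpow (by positivity) hw.le]
      congr 3 <;> ring
    have h3 : w * w ^ (θ - 1) = w ^ θ := by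
      rw [Real.rpow_sub_one hw.ne']
      field_simp
    calc _ ≤ w * (2 * ρ) ^ b := by gcongr
      _ = 2 ^ b * (A / t) ^ (θ - 1) * (w * w ^ (θ - 1)) := by rw [h2]; ring
      _ = _ := by rw [h3]
  · have h1 : ((2 : ℝ) ^ (n + 1)) ^ (-β) ≤ ρ ^ (-β) :=
      Real.rpow_le_rpow_of_nonpos hρ0 hn2.le (by linarith)
    have h2 : ρ ^ (-β) = (A / t * w)⁻¹ := by
      rw [hρ, ← Real.rpow_mul (by positivity), ← Real.rpow_neg_one]
      congr 1
      field_simp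
    calc _ ≤ w * ρ ^ (-β) := by gcongr
      _ = _ := by
        rw [h2]
        field_simp

theorem enorm_mul_add_sq_le (z a b : ℂ) :
    ‖z * (a + b)‖ₑ ^ 2 ≤ 2 * ‖z * a‖ₑ ^ 2 + 2 * (‖z‖ₑ ^ 2 * ‖b‖ₑ ^ 2) := by
  rw [← mul_pow, ← enorm_mul, mul_add]
  simp only [← ofReal_norm, ← ENNReal.ofReal_pow (norm_nonneg _)]
  rw [← ENNReal.ofReal_ofNat, ← ENNReal.ofReal_mul zero_le_two, ← ENNReal.ofReal_mul zero_le_two,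
    ← ENNReal.ofReal_add (by positivity) (by positivity)]
  refine ENNReal.ofReal_le_ofReal ?_
  have h := norm_add_le (z * a) (z * b)
  have h2 : ‖z * a + z * b‖ ^ 2 ≤ (‖z * a‖ + ‖z * b‖) ^ 2 := by gcongr
  nlinarith [sq_nonneg (‖z * a‖ - ‖z * b‖)]

/-- The Cwikel-type splitting: multiplication by `f` is, up to an operator of small norm, given by
a Hilbert–Schmidt field of functionals. -/
theorem exists_splitting {s θ : ℝ} (hl : 0 < l) (hlN : 2 * (l : ℝ) < N)
    (hs : (N : ℝ) - 2 * l < s) (hθ : θ = s / (2 * l - N + s)) :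
    ∃ C : ℝ, 0 < C ∧ ∀ (μ : Measure (Eucl N)) (A : ℝ), 0 < A → GlobalAhlfors μ s A →
      ∀ (f : Eucl N → ℂ) (t : ℝ), 0 < t → ∃ ℓ : Eucl N → HomSobolev N l →L[ℂ] ℂ,
        (∀ x, ‖ℓ x‖ₑ ^ 2 ≤ ENNReal.ofReal (C * (A / t) ^ (θ - 1) * (‖f x‖ ^ 2) ^ θ)) ∧
        ∀ v : HomTest N l, ∫⁻ x, ‖f x * v.fn x‖ₑ ^ 2 ∂μ ≤
          2 * ∫⁻ x, ‖ℓ x v.toSobolev‖ₑ ^ 2 ∂μ + ENNReal.ofReal (C * t * ‖v‖ ^ 2) := by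
  set β : ℝ := 2 * l - N + s with hβdef
  have hβ : 0 < β := by linarith
  have hb : (0 : ℝ) < N - 2 * l := by linarith
  have hθ1 : θ - 1 = (N - 2 * l) / β := by
    rw [hθ]
    field_simp
    linarith
  obtain ⟨C₁, hC₁, hlow⟩ := exists_norm_band_ball_sq_le hl hlN
  obtain ⟨C₂, hC₂, hsq⟩ := exists_lintegral_squareFn_le N l s
  have hr1 : (2 : ℝ) ^ (-β) < 1 := Real.rpow_lt_one_of_one_lt_of_neg one_lt_two (by linarith)
  have hκ : 0 < (1 - (2 : ℝ) ^ (-β))⁻¹ := inv_pos.2 (by linarith)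
  set κ : ℝ := (1 - (2 : ℝ) ^ (-β))⁻¹ with hκdef
  refine ⟨max (C₁ * 2 ^ ((N : ℝ) - 2 * l)) (2 * κ * C₂), by positivity,
    fun μ A hA hμ f t ht => ?_⟩
  -- No measurability of `x ↦ m x` is claimed; only the measurable majorants enter as integrands to
  -- be split off.
  choose m hm1 hm2 using fun x => exists_scale hb hβ hθ1 hA ht (sq_nonneg ‖f x‖)
  let φ : Eucl N → HomTest N l →ₗ[ℂ] ℂ := fun x =>
    { toFun := fun v => f x * v.band (Metric.ball 0 ((2 : ℝ) ^ m x)) x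
      map_add' := fun v w => by rw [v.band_add w measurableSet_ball, mul_add]
      map_smul' := fun c v => by
        rw [v.band_smul c measurableSet_ball, RingHom.id_apply, smul_eq_mul]; ring }
  set B : Eucl N → ℝ := fun x => C₁ * 2 ^ ((N : ℝ) - 2 * l) * (A / t) ^ (θ - 1) *
    (‖f x‖ ^ 2) ^ θ with hB
  have hB0 : ∀ x, 0 ≤ B x := fun x => by positivity
  have hφ : ∀ x v, ‖φ x v‖ ≤ √(B x) * ‖v‖ := by
    intro x v
    refine abs_le_of_sq_le_sq' ?_ (by positivity) |>.2
    rw [mul_pow, Real.sq_sqrt (hB0 x)]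
    calc ‖φ x v‖ ^ 2 = ‖f x‖ ^ 2 * ‖v.band (Metric.ball 0 ((2 : ℝ) ^ m x)) x‖ ^ 2 := by
          rw [← mul_pow, ← norm_mul]; rfl
      _ ≤ ‖f x‖ ^ 2 * (C₁ * ((2 : ℝ) ^ m x) ^ ((N : ℝ) - 2 * l) * ‖v‖ ^ 2) := by
          have := hlow v ((2 : ℝ) ^ m x) (by positivity) x
          gcongr
      _ = C₁ * (‖f x‖ ^ 2 * ((2 : ℝ) ^ m x) ^ ((N : ℝ) - 2 * l)) * ‖v‖ ^ 2 := by ring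
      _ ≤ C₁ * (2 ^ ((N : ℝ) - 2 * l) * (A / t) ^ (θ - 1) * (‖f x‖ ^ 2) ^ θ) * ‖v‖ ^ 2 := by
          have := hm1 x
          gcongr
      _ = _ := by rw [hB]; ring
  choose ℓ hℓ hℓn using fun x => exists_extension (φ x) (Real.sqrt_nonneg _) (hφ x)
  refine ⟨ℓ, fun x => ?_, fun v => ?_⟩
  · rw [← ofReal_norm, ← ENNReal.ofReal_pow (norm_nonneg _)]
    refine ENNReal.ofReal_le_ofReal ?_
    calc ‖ℓ x‖ ^ 2 ≤ √(B x) ^ 2 := by gcongr; exact hℓn x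
      _ = B x := Real.sq_sqrt (hB0 x)
      _ ≤ _ := by
        simp only [hB]
        gcongr
        exact le_max_left _ _
  · have hpt : ∀ x, ‖f x * v.fn x‖ₑ ^ 2 ≤ 2 * ‖ℓ x v.toSobolev‖ₑ ^ 2 +
        ENNReal.ofReal (2 * κ * (t / A)) * v.squareFn β x := by
      intro x
      rw [hℓ, v.fn_eq_band_add_band_compl (measurableSet_ball (x := 0) (ε := (2 : ℝ) ^ m x)) x]
      refine (enorm_mul_add_sq_le _ _ _).trans (add_le_add_right ?_ _)
      calc _ ≤ 2 * (‖f x‖ₑ ^ 2 * (ENNReal.ofReal (κ * ((2 : ℝ) ^ m x) ^ (-β)) *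
            v.squareFn β x)) := by
            gcongr
            exact v.enorm_band_compl_ball_sq_le hβ (m x) x
        _ = ENNReal.ofReal (2 * κ * (‖f x‖ ^ 2 * ((2 : ℝ) ^ m x) ^ (-β))) * v.squareFn β x := by
            rw [← ofReal_norm, ← ENNReal.ofReal_pow (norm_nonneg _), ← mul_assoc, ← mul_assoc,
              ← ENNReal.ofReal_ofNat, ← ENNReal.ofReal_mul zero_le_two,
              ← ENNReal.ofReal_mul (by positivity)]
            congr 2
            ring
        _ ≤ _ := by
            have := hm2 x
            gcongr
    calc _ ≤ ∫⁻ x, 2 * ‖ℓ x v.toSobolev‖ₑ ^ 2 +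
          ENNReal.ofReal (2 * κ * (t / A)) * v.squareFn β x ∂μ := lintegral_mono hpt
      _ = 2 * ∫⁻ x, ‖ℓ x v.toSobolev‖ₑ ^ 2 ∂μ +
          ENNReal.ofReal (2 * κ * (t / A)) * ∫⁻ x, v.squareFn β x ∂μ := by
          -- Additivity needs only the square function to be measurable, not the field `ℓ`.
          rw [lintegral_add_right _ ((v.measurable_squareFn β).const_mul _),
            lintegral_const_mul' _ _ (by simp), lintegral_const_mul' _ _ ENNReal.ofReal_ne_top]
      _ ≤ 2 * ∫⁻ x, ‖ℓ x v.toSobolev‖ₑ ^ 2 ∂μ +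
          ENNReal.ofReal (2 * κ * (t / A)) * ENNReal.ofReal (C₂ * A * ‖v‖ ^ 2) := by
          gcongr
          exact hsq μ A hA hμ v
      _ ≤ _ := by
          rw [← ENNReal.ofReal_mul (by positivity)]
          refine add_le_add_right (ENNReal.ofReal_le_ofReal ?_) _
          calc _ = 2 * κ * C₂ * t * ‖v‖ ^ 2 := by field_simp
            _ ≤ _ := by
              gcongr
              exact le_max_right _ _

/-- An estimate by a Hilbert–Schmidt field passes from a dense set to the whole space. -/
theorem norm_sq_le_of_denseRange {D H F X : Type*} [NormedAddCommGroup H] [InnerProductSpace ℂ H]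
    [NormedAddCommGroup F] [NormedSpace ℂ F] [MeasurableSpace X] {μ : Measure X} {e : D → H}
    (he : DenseRange e) (T : H →L[ℂ] F) {ℓ : X → H →L[ℂ] ℂ} {b : X → ℝ≥0∞}
    (hb : ∀ x, ‖ℓ x‖ₑ ^ 2 ≤ b x) (hbm : AEMeasurable b μ) {K c : ℝ} (hK0 : 0 ≤ K) (hc : 0 ≤ c)
    (hK : ∫⁻ x, b x ∂μ ≤ ENNReal.ofReal K)
    (h : ∀ v, ENNReal.ofReal (‖T (e v)‖ ^ 2) ≤
      2 * ∫⁻ x, ‖ℓ x (e v)‖ₑ ^ 2 ∂μ + ENNReal.ofReal (c * ‖e v‖ ^ 2)) (u : H) :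
    ENNReal.ofReal (‖T u‖ ^ 2) ≤
      4 * ∫⁻ x, ‖ℓ x u‖ₑ ^ 2 ∂μ + ENNReal.ofReal (c * ‖u‖ ^ 2) := by
  -- Freezing `u` inside the integral makes both sides continuous in `w`, so density applies; `w =
  -- u` gives the claim. Replacing `e v` by `u` in the field doubles the factor `2` and costs an
  -- error absorbed in the `K`-term.
  have key : ∀ w : H, ENNReal.ofReal (‖T w‖ ^ 2) ≤ 4 * ∫⁻ x, ‖ℓ x u‖ₑ ^ 2 ∂μ +
      ENNReal.ofReal (4 * K * ‖w - u‖ ^ 2 + c * ‖w‖ ^ 2) := by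
    intro w
    induction w using he.induction_on with
    | hp =>
      exact isClosed_le (ENNReal.continuous_ofReal.comp (by fun_prop))
        (continuous_const.add (ENNReal.continuous_ofReal.comp (by fun_prop)))
    | ih v =>
      refine (h v).trans ?_
      rw [ENNReal.ofReal_add (by positivity) (by positivity), ← add_assoc]
      refine add_le_add_left ?_ _
      have hpt : ∀ x, ‖ℓ x (e v)‖ₑ ^ 2 ≤ 2 * ‖ℓ x u‖ₑ ^ 2 +
          2 * ENNReal.ofReal (‖e v - u‖ ^ 2) * b x := by
        intro x
        have h1 := enorm_mul_add_sq_le 1 (ℓ x u) (ℓ x (e v - u))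
        rw [← map_add, add_sub_cancel] at h1
        simp only [one_mul, enorm_one, one_pow] at h1
        refine h1.trans (add_le_add_right ?_ _)
        rw [mul_assoc]
        gcongr
        calc ‖ℓ x (e v - u)‖ₑ ^ 2 ≤ (‖ℓ x‖ₑ * ‖e v - u‖ₑ) ^ 2 := by
              gcongr; exact (ℓ x).le_opENorm _
          _ = ENNReal.ofReal (‖e v - u‖ ^ 2) * ‖ℓ x‖ₑ ^ 2 := by
              rw [mul_pow, mul_comm, ENNReal.ofReal_pow (norm_nonneg _), ofReal_norm]
          _ ≤ _ := by gcongr; exact hb x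
      calc 2 * ∫⁻ x, ‖ℓ x (e v)‖ₑ ^ 2 ∂μ ≤ 2 * ∫⁻ x, 2 * ‖ℓ x u‖ₑ ^ 2 +
            2 * ENNReal.ofReal (‖e v - u‖ ^ 2) * b x ∂μ := by
            gcongr with x
            exact hpt x
        _ = 4 * ∫⁻ x, ‖ℓ x u‖ₑ ^ 2 ∂μ +
            4 * ENNReal.ofReal (‖e v - u‖ ^ 2) * ∫⁻ x, b x ∂μ := by
            rw [lintegral_add_right' _ (hbm.const_mul _), lintegral_const_mul' _ _ (by simp),
              lintegral_const_mul' _ _ (ENNReal.mul_ne_top (by simp) ENNReal.ofReal_ne_top)]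
            ring
        _ ≤ 4 * ∫⁻ x, ‖ℓ x u‖ₑ ^ 2 ∂μ +
            4 * ENNReal.ofReal (‖e v - u‖ ^ 2) * ENNReal.ofReal K := by gcongr
        _ = _ := by
            rw [← ENNReal.ofReal_ofNat, ← ENNReal.ofReal_mul (by norm_num),
              ← ENNReal.ofReal_mul (by positivity)]
            congr 2
            ring
  simpa using key u

end Splitting

/-! ### Multiplication operators into `L₂(μ)`. -/

section Multiplication

variable {N : ℕ} {l : ℝ≥0}

/-- `T` is the operator of multiplication by `f` from the Sobolev space to `L₂(μ)`. -/
def IsMulOperator (μ : Measure (Eucl N)) (f : Eucl N → ℂ) (T : HomSobolev N l →L[ℂ] Lp ℂ 2 μ) :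
    Prop :=
  ∀ v : HomTest N l, T v.toSobolev =ᵐ[μ] fun x => f x * v.fn x

/-- Multiplication by `f` is bounded from the Sobolev space to `L₂(μ)`, and it is small off
subspaces of controlled dimension. -/
theorem exists_isMulOperator {s θ : ℝ} (hl : 0 < l) (hlN : 2 * (l : ℝ) < N)
    (hs : (N : ℝ) - 2 * l < s) (hθ : θ = s / (2 * l - N + s)) :
    ∃ C : ℝ, 0 < C ∧ ∀ (μ : Measure (Eucl N)) (A : ℝ), 0 < A → GlobalAhlfors μ s A →
      ∀ f : Eucl N → ℂ, AEStronglyMeasurable f μ → Integrable (fun x => (‖f x‖ ^ 2) ^ θ) μ →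
        ∃ T : HomSobolev N l →L[ℂ] Lp ℂ 2 μ, IsMulOperator μ f T ∧
          ∀ ε : ℝ, 0 < ε → ∃ M : Submodule ℂ (HomSobolev N l), FiniteDimensional ℂ M ∧
            (Module.finrank ℂ M : ℝ) ≤
              C * A ^ (θ - 1) * (∫ x, (‖f x‖ ^ 2) ^ θ ∂μ) * ε ^ (-θ) ∧
            ∀ u ∈ Mᗮ, ‖T u‖ ^ 2 ≤ ε * ‖u‖ ^ 2 := by
  obtain ⟨C, hC, hsplit⟩ := exists_splitting hl hlN hs hθ
  refine ⟨8 * C * (2 * C) ^ (θ - 1), by positivity, fun μ A hA hμ f hf hfi => ?_⟩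
  set J := ∫ x, (‖f x‖ ^ 2) ^ θ ∂μ with hJ
  have hJ0 : 0 ≤ J := integral_nonneg fun x => by positivity
  have hbint : ∀ t : ℝ, 0 < t → ∫⁻ x, ENNReal.ofReal (C * (A / t) ^ (θ - 1) * (‖f x‖ ^ 2) ^ θ) ∂μ =
      ENNReal.ofReal (C * (A / t) ^ (θ - 1) * J) := by
    intro t ht
    rw [← ofReal_integral_eq_lintegral_ofReal (hfi.const_mul _)
      (Filter.Eventually.of_forall fun x => by positivity), integral_const_mul]
  -- Any fixed `t` yields boundedness; the sharp dependence on `ε` comes from a second use of the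
  -- splitting.
  obtain ⟨ℓ₁, hℓ₁b, hℓ₁⟩ := hsplit μ A hA hμ f 1 one_pos
  set K : ℝ := 2 * (C * (A / 1) ^ (θ - 1) * J) + C * 1 with hK
  have hK0 : 0 ≤ K := by positivity
  have hbdd : ∀ v : HomTest N l, ∫⁻ x, ‖f x * v.fn x‖ₑ ^ 2 ∂μ ≤ ENNReal.ofReal (K * ‖v‖ ^ 2) := by
    intro v
    refine (hℓ₁ v).trans ?_
    have h1 : ∫⁻ x, ‖ℓ₁ x v.toSobolev‖ₑ ^ 2 ∂μ ≤
        ENNReal.ofReal (‖v‖ ^ 2) * ENNReal.ofReal (C * (A / 1) ^ (θ - 1) * J) := by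
      rw [← hbint 1 one_pos, ← lintegral_const_mul' _ _ ENNReal.ofReal_ne_top]
      refine lintegral_mono fun x => ?_
      calc ‖ℓ₁ x v.toSobolev‖ₑ ^ 2 ≤ (‖ℓ₁ x‖ₑ * ‖v.toSobolev‖ₑ) ^ 2 := by
            gcongr; exact (ℓ₁ x).le_opENorm _
        _ = ENNReal.ofReal (‖v‖ ^ 2) * ‖ℓ₁ x‖ₑ ^ 2 := by
            rw [mul_pow, mul_comm, ENNReal.ofReal_pow (norm_nonneg _), ← v.norm_toSobolev,
              ofReal_norm]
        _ ≤ _ := by gcongr; exact hℓ₁b x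
    calc _ ≤ 2 * (ENNReal.ofReal (‖v‖ ^ 2) * ENNReal.ofReal (C * (A / 1) ^ (θ - 1) * J)) +
          ENNReal.ofReal (C * 1 * ‖v‖ ^ 2) := by gcongr
      _ = _ := by
          rw [← ENNReal.ofReal_mul (by positivity), ← ENNReal.ofReal_ofNat,
            ← ENNReal.ofReal_mul (by norm_num), ← ENNReal.ofReal_add (by positivity)
            (by positivity)]
          congr 1
          rw [hK]
          ring
  have hmem : ∀ v : HomTest N l, MemLp (fun x => f x * v.fn x) 2 μ := by
    intro v
    refine ⟨hf.mul v.contDiff.continuous.aestronglyMeasurable, ?_⟩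
    rw [eLpNorm_lt_top_iff_lintegral_rpow_enorm_lt_top two_ne_zero ENNReal.ofNat_ne_top]
    simp only [ENNReal.toReal_ofNat, ENNReal.rpow_ofNat]
    exact (hbdd v).trans_lt ENNReal.ofReal_lt_top
  have hnorm : ∀ (g : Lp ℂ 2 μ), ENNReal.ofReal (‖g‖ ^ 2) = ∫⁻ x, ‖g x‖ₑ ^ 2 ∂μ := by
    intro g
    rw [ENNReal.ofReal_pow (norm_nonneg _), ofReal_norm, Lp.enorm_def,
      eLpNorm_eq_lintegral_rpow_enorm_toReal two_ne_zero ENNReal.ofNat_ne_top,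
      ← ENNReal.rpow_natCast, ← ENNReal.rpow_mul]
    simp
  let φ : HomTest N l →ₗ[ℂ] Lp ℂ 2 μ :=
    { toFun := fun v => (hmem v).toLp _
      map_add' := fun v w => by
        rw [← MemLp.toLp_add]
        exact MemLp.toLp_congr _ _ (Filter.Eventually.of_forall fun x => by
          simp only [HomTest.fn_add, Pi.add_apply, mul_add])
      map_smul' := fun c v => by
        rw [RingHom.id_apply, ← MemLp.toLp_const_smul]
        exact MemLp.toLp_congr _ _ (Filter.Eventually.of_forall fun x => by
          simp only [HomTest.fn_smul, Pi.smul_apply, smul_eq_mul]; ring) }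
  have hφn : ∀ v, ENNReal.ofReal (‖φ v‖ ^ 2) = ∫⁻ x, ‖f x * v.fn x‖ₑ ^ 2 ∂μ := by
    intro v
    rw [hnorm]
    refine lintegral_congr_ae ?_
    filter_upwards [(hmem v).coeFn_toLp] with x hx
    exact congrArg (fun z => ‖z‖ₑ ^ 2) hx
  have hφb : ∀ v, ‖φ v‖ ≤ √K * ‖v‖ := by
    intro v
    refine abs_le_of_sq_le_sq' ?_ (by positivity) |>.2
    rw [mul_pow, Real.sq_sqrt hK0]
    have := hbdd v
    rw [← hφn] at this
    exact (ENNReal.ofReal_le_ofReal_iff (by positivity)).1 this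
  obtain ⟨T, hT, -⟩ := exists_extension φ (Real.sqrt_nonneg K) hφb
  refine ⟨T, fun v => ?_, fun ε hε => ?_⟩
  · rw [hT]
    exact (hmem v).coeFn_toLp
  -- The high part contributes `C t = ε / 2`, and the field, made at most `ε / 8` off `M`,
  -- contributes `4 · ε / 8 = ε / 2`.
  · set t : ℝ := ε / (2 * C) with ht
    have ht0 : 0 < t := by positivity
    obtain ⟨ℓ, hℓb, hℓ⟩ := hsplit μ A hA hμ f t ht0
    have hKt : 0 ≤ C * (A / t) ^ (θ - 1) * J := by positivity
    obtain ⟨M, hM, hMr, hMu⟩ := exists_submodule_lintegral_le μ ℓ _ hℓb hKt (hbint t ht0).le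
      (by positivity : (0 : ℝ) < ε / 8)
    refine ⟨M, hM, ?_, fun u hu => ?_⟩
    · have h1 : (A / t) ^ (θ - 1) = A ^ (θ - 1) * (2 * C) ^ (θ - 1) * (ε ^ (-θ) * ε) := by
        have e1 : A / t = A * (2 * C) * ε⁻¹ := by rw [ht]; field_simp
        rw [e1, Real.mul_rpow (by positivity) (by positivity), Real.mul_rpow hA.le (by positivity),
          Real.inv_rpow hε.le, ← Real.rpow_neg hε.le, ← Real.rpow_add_one hε.ne']
        congr 2
        ring
      rw [h1] at hMr
      have h2 : C * (A ^ (θ - 1) * (2 * C) ^ (θ - 1) * (ε ^ (-θ) * ε)) * J =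
          (8 * C * (2 * C) ^ (θ - 1) * A ^ (θ - 1) * J * ε ^ (-θ)) * (ε / 8) := by ring
      rw [h2] at hMr
      exact le_of_mul_le_mul_right hMr (by positivity)
    · have h1 := norm_sq_le_of_denseRange denseRange_toSobolev T hℓb
        (by have := hfi.aestronglyMeasurable.aemeasurable; fun_prop) hKt
        (by positivity : 0 ≤ C * t) (hbint t ht0).le
        (fun v => by rw [hT, hφn, v.norm_toSobolev]; exact hℓ v) u
      have h2 : 4 * ∫⁻ x, ‖ℓ x u‖ₑ ^ 2 ∂μ + ENNReal.ofReal (C * t * ‖u‖ ^ 2) ≤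
          ENNReal.ofReal (ε * ‖u‖ ^ 2) := by
        calc _ ≤ 4 * ENNReal.ofReal (ε / 8 * ‖u‖ ^ 2) + ENNReal.ofReal (C * t * ‖u‖ ^ 2) := by
              gcongr; exact hMu u hu
          _ = _ := by
              rw [← ENNReal.ofReal_ofNat, ← ENNReal.ofReal_mul (by norm_num),
                ← ENNReal.ofReal_add (by positivity) (by positivity)]
              congr 1
              rw [ht]
              field_simp
              ring
      exact (ENNReal.ofReal_le_ofReal_iff (by positivity)).1 (h1.trans h2)

end Multiplication

end BirmanSchwinger

end

noncomputable section

namespace BirmanSchwinger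

/-! ### Operators defined by their quadratic forms. -/

section FormOperator

variable {N : ℕ} {l : ℝ≥0} {μ : Measure (Eucl N)}

theorem IsMulOperator.isFormOperator {f₁ f₂ V : Eucl N → ℂ}
    {T₁ T₂ : HomSobolev N l →L[ℂ] Lp ℂ 2 μ} (h₁ : IsMulOperator μ f₁ T₁)
    (h₂ : IsMulOperator μ f₂ T₂) (hV : ∀ x, conj (f₁ x) * f₂ x = V x) :
    IsFormOperator μ V (ContinuousLinearMap.adjoint T₁ ∘L T₂) := by
  intro v
  have hae : (fun x => inner ℂ (T₁ v.toSobolev x) (T₂ v.toSobolev x)) =ᵐ[μ]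
      fun x => V x * (‖v.fn x‖ : ℂ) ^ 2 := by
    filter_upwards [h₁ v, h₂ v] with x hx₁ hx₂
    rw [hx₁, hx₂, RCLike.inner_apply, ← hV, ← Complex.mul_conj', map_mul]
    ring
  refine ⟨(L2.integrable_inner _ _).congr hae, ?_⟩
  rw [ContinuousLinearMap.comp_apply, ContinuousLinearMap.adjoint_inner_right, L2.inner_def]
  exact integral_congr_ae hae

/-- Over `ℂ` the quadratic form determines the operator by polarization, and it vanishes for `S -
S'` by density. -/
theorem IsFormOperator.unique {V : Eucl N → ℂ} {S S' : HomSobolev N l →L[ℂ] HomSobolev N l}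
    (h : IsFormOperator μ V S) (h' : IsFormOperator μ V S') : S = S' := by
  have hz : ∀ u : HomSobolev N l, inner ℂ ((S - S') u) u = 0 := by
    intro u
    induction u using denseRange_toSobolev.induction_on with
    | hp => exact isClosed_eq (by fun_prop) continuous_const
    | ih v =>
      rw [← inner_conj_symm, sub_apply, inner_sub_right, (h v).2, (h' v).2,
        sub_self, map_zero]
  have := (inner_map_self_eq_zero ((S - S' : HomSobolev N l →L[ℂ] HomSobolev N l) :
    HomSobolev N l →ₗ[ℂ] HomSobolev N l)).1 hz
  refine ContinuousLinearMap.ext fun u => ?_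
  have hu := LinearMap.congr_fun this u
  exact sub_eq_zero.1 hu

theorem IsFormOperator.neg {V : Eucl N → ℂ} {S : HomSobolev N l →L[ℂ] HomSobolev N l}
    (h : IsFormOperator μ V S) : IsFormOperator μ (fun x => -V x) (-S) := by
  intro v
  refine ⟨by simpa only [neg_mul] using (h v).1.fun_neg, ?_⟩
  simp only [neg_mul, integral_neg, neg_apply, inner_neg_right, (h v).2]

theorem IsFormOperator.isSelfAdjoint {V : Eucl N → ℝ} {S : HomSobolev N l →L[ℂ] HomSobolev N l}
    (h : IsFormOperator μ (fun x => (V x : ℂ)) S) : IsSelfAdjoint S := by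
  rw [ContinuousLinearMap.isSelfAdjoint_iff_isSymmetric,
    LinearMap.isSymmetric_iff_inner_map_self_real]
  intro u
  rw [ContinuousLinearMap.coe_coe]
  induction u using denseRange_toSobolev.induction_on with
  | hp => exact isClosed_eq (Complex.continuous_conj.comp (by fun_prop)) (by fun_prop)
  | ih v =>
    rw [inner_conj_symm, ← inner_conj_symm (S v.toSobolev), (h v).2, ← integral_conj]
    congr 1
    ext x
    simp

/-- Forms of real potentials are monotone in the potential. -/
theorem IsFormOperator.re_inner_le {V : Eucl N → ℝ} {S : HomSobolev N l →L[ℂ] HomSobolev N l}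
    (h : IsFormOperator μ (fun x => (V x : ℂ)) S) {f : Eucl N → ℝ}
    {T : HomSobolev N l →L[ℂ] Lp ℂ 2 μ} (hT : IsMulOperator μ (fun x => (f x : ℂ)) T)
    (hVf : ∀ x, V x ≤ f x ^ 2) (u : HomSobolev N l) :
    (inner ℂ u (S u)).re ≤ ‖T u‖ ^ 2 := by
  have hTT := hT.isFormOperator hT (V := fun x => ((f x ^ 2 : ℝ) : ℂ)) fun x => by
    rw [Complex.conj_ofReal]
    push_cast
    ring
  induction u using denseRange_toSobolev.induction_on with
  | hp => exact isClosed_le (Complex.continuous_re.comp (by fun_prop)) (by fun_prop)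
  | ih v =>
    obtain ⟨hi₁, he₁⟩ := h v
    obtain ⟨hi₂, he₂⟩ := hTT v
    rw [ContinuousLinearMap.comp_apply, ContinuousLinearMap.adjoint_inner_right,
      inner_self_eq_norm_sq_to_K] at he₂
    have h2 : ‖T v.toSobolev‖ ^ 2 =
        (∫ x, ((f x ^ 2 : ℝ) : ℂ) * (‖v.fn x‖ : ℂ) ^ 2 ∂μ).re := by
      rw [← he₂]
      norm_cast
    have e : ∀ g : Eucl N → ℝ, (fun x => (g x : ℂ) * (‖v.fn x‖ : ℂ) ^ 2) =
        fun x => ((g x * ‖v.fn x‖ ^ 2 : ℝ) : ℂ) := fun g => by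
      ext x
      push_cast
      rfl
    rw [h2, he₁, e V, e fun x => f x ^ 2, integral_complex_ofReal, integral_complex_ofReal,
      Complex.ofReal_re, Complex.ofReal_re]
    rw [e V] at hi₁
    rw [e fun x => f x ^ 2] at hi₂
    refine integral_mono hi₁.re hi₂.re fun x => ?_
    have := hVf x
    gcongr

theorem IsMulOperator.norm_eq {f₁ f₂ : Eucl N → ℂ} {T₁ T₂ : HomSobolev N l →L[ℂ] Lp ℂ 2 μ}
    (h₁ : IsMulOperator μ f₁ T₁) (h₂ : IsMulOperator μ f₂ T₂) (h : ∀ x, ‖f₁ x‖ = ‖f₂ x‖)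
    (u : HomSobolev N l) : ‖T₁ u‖ = ‖T₂ u‖ := by
  induction u using denseRange_toSobolev.induction_on with
  | hp => exact isClosed_eq (by fun_prop) (by fun_prop)
  | ih v =>
    have hae : ∀ᵐ x ∂μ, ‖T₁ v.toSobolev x‖ = ‖T₂ v.toSobolev x‖ := by
      filter_upwards [h₁ v, h₂ v] with x hx₁ hx₂
      rw [hx₁, hx₂, norm_mul, norm_mul, h]
    exact le_antisymm (Lp.norm_le_norm_of_ae_le (hae.mono fun x hx => hx.le))
      (Lp.norm_le_norm_of_ae_le (hae.mono fun x hx => hx.ge))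

/-- The factorization of `V` into factors of equal modulus; where `V` vanishes, division by zero
gives `0`, as needed. -/
theorem conj_sqrt_mul_div_sqrt (z : ℂ) :
    conj ((√‖z‖ : ℝ) : ℂ) * (z / ((√‖z‖ : ℝ) : ℂ)) = z := by
  rcases eq_or_ne z 0 with rfl | hz
  · simp
  · rw [Complex.conj_ofReal]
    refine mul_div_cancel₀ z ?_
    exact Complex.ofReal_ne_zero.2 (Real.sqrt_pos.2 (norm_pos_iff.2 hz)).ne'

theorem norm_sqrt_sq (z : ℂ) : ‖((√‖z‖ : ℝ) : ℂ)‖ ^ 2 = ‖z‖ := by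
  rw [Complex.norm_real, Real.norm_of_nonneg (Real.sqrt_nonneg _), Real.sq_sqrt (norm_nonneg _)]

theorem norm_sqrt_eq_norm_div_sqrt (z : ℂ) :
    ‖((√‖z‖ : ℝ) : ℂ)‖ = ‖z / ((√‖z‖ : ℝ) : ℂ)‖ := by
  rw [norm_div, Complex.norm_real, Real.norm_of_nonneg (Real.sqrt_nonneg _), Real.div_sqrt]

end FormOperator

/-- Multiplication operators are well behaved: bounded and small off subspaces of dimension
controlled by `C A^{θ-1} ∫ |f|^{2θ} ε^{-θ}`. -/
def MulOperatorBound (N : ℕ) (l : ℝ≥0) (θ C A : ℝ) (μ : Measure (Eucl N)) : Prop :=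
  ∀ f : Eucl N → ℂ, AEStronglyMeasurable f μ → Integrable (fun x => (‖f x‖ ^ 2) ^ θ) μ →
    ∃ T : HomSobolev N l →L[ℂ] Lp ℂ 2 μ, IsMulOperator μ f T ∧
      ∀ ε : ℝ, 0 < ε → ∃ M : Submodule ℂ (HomSobolev N l), FiniteDimensional ℂ M ∧
        (Module.finrank ℂ M : ℝ) ≤ C * A ^ (θ - 1) * (∫ x, (‖f x‖ ^ 2) ^ θ ∂μ) * ε ^ (-θ) ∧
        ∀ u ∈ Mᗮ, ‖T u‖ ^ 2 ≤ ε * ‖u‖ ^ 2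

/-! ### Counting estimates for real and complex potentials. -/

section Main

variable {N : ℕ} {l : ℝ≥0} {μ : Measure (Eucl N)} {θ C A : ℝ}

theorem natCast_toENNReal_le {n : ℕ∞} {m : ℕ} {r : ℝ} (h : n ≤ (m : ℕ∞)) (hr : (m : ℝ) ≤ r) :
    (n : ℝ≥0∞) ≤ ENNReal.ofReal r := by
  calc (n : ℝ≥0∞) ≤ ((m : ℕ∞) : ℝ≥0∞) := by gcongr
    _ = ENNReal.ofReal (m : ℝ) := by simp
    _ ≤ _ := ENNReal.ofReal_le_ofReal hr

theorem half_rpow_neg {t : ℝ} (ht : 0 < t) (θ : ℝ) : (t / 2) ^ (-θ) = 2 ^ θ * t ^ (-θ) := by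
  rw [div_eq_mul_inv, Real.mul_rpow ht.le (by norm_num), Real.inv_rpow zero_le_two,
    Real.rpow_neg zero_le_two, inv_inv, mul_comm]

theorem integrable_rpow_of_memLp {E : Type*} [NormedAddCommGroup E] (hθ : 0 < θ)
    {V : Eucl N → E} (hV : MemLp V (ENNReal.ofReal θ) μ) :
    Integrable (fun x => ‖V x‖ ^ θ) μ := by
  have h := hV.integrable_norm_rpow (by simpa using hθ) ENNReal.ofReal_ne_top
  rwa [ENNReal.toReal_ofReal hθ.le] at h

theorem MulOperatorBound.isCompactOperator {f : Eucl N → ℂ} {T : HomSobolev N l →L[ℂ] Lp ℂ 2 μ}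
    (hT : ∀ ε : ℝ, 0 < ε → ∃ M : Submodule ℂ (HomSobolev N l), FiniteDimensional ℂ M ∧
        (Module.finrank ℂ M : ℝ) ≤ C * A ^ (θ - 1) * (∫ x, (‖f x‖ ^ 2) ^ θ ∂μ) * ε ^ (-θ) ∧
        ∀ u ∈ Mᗮ, ‖T u‖ ^ 2 ≤ ε * ‖u‖ ^ 2) : IsCompactOperator T :=
  isCompactOperator_of_small_off_finite T fun ε hε =>
    let ⟨M, h1, _, h2⟩ := hT ε hε
    ⟨M, h1, h2⟩

/-- The two factors of `V` have equal modulus, so `‖T₁ u‖ = ‖T₂ u‖` and a single subspace handles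
both sides of the form. The constant gains `2^θ` from `ε = t / 2` and `2` from the doubled dimension
in `nSing_le_finrank`. -/
theorem MulOperatorBound.complex_potential (h : MulOperatorBound N l θ C A μ) (hθ : 0 < θ)
    {V : Eucl N → ℂ} (hV : MemLp V (ENNReal.ofReal θ) μ) :
    ∃ S : HomSobolev N l →L[ℂ] HomSobolev N l, IsFormOperator μ V S ∧ IsCompactOperator S ∧
      ∀ t : ℝ, 0 < t → (nSing t S : ℝ≥0∞) ≤
        ENNReal.ofReal (C * 2 ^ θ * 2 * A ^ (θ - 1) * (∫ x, ‖V x‖ ^ θ ∂μ) * t ^ (-θ)) := by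
  have hVi := integrable_rpow_of_memLp hθ hV
  have hVm : AEMeasurable V μ := hV.1.aemeasurable
  obtain ⟨T₁, hT₁, hM₁⟩ := h (fun x => ((√‖V x‖ : ℝ) : ℂ))
    (AEMeasurable.aestronglyMeasurable (by fun_prop)) (by simpa only [norm_sqrt_sq] using hVi)
  obtain ⟨T₂, hT₂, hM₂⟩ := h (fun x => V x / ((√‖V x‖ : ℝ) : ℂ))
    (AEMeasurable.aestronglyMeasurable (by fun_prop))
    (by simpa only [← norm_sqrt_eq_norm_div_sqrt, norm_sqrt_sq] using hVi)
  have heq := hT₁.norm_eq hT₂ fun x => norm_sqrt_eq_norm_div_sqrt (V x)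
  refine ⟨ContinuousLinearMap.adjoint T₁ ∘L T₂,
    hT₁.isFormOperator hT₂ fun x => conj_sqrt_mul_div_sqrt (V x),
    (MulOperatorBound.isCompactOperator hM₂).clm_comp (ContinuousLinearMap.adjoint T₁),
    fun t ht => ?_⟩
  obtain ⟨M, hMf, hMr, hMu⟩ := hM₁ (t / 2) (by positivity)
  refine natCast_toENNReal_le (nSing_le_finrank (T := T₁) (fun u w => ?_) (by positivity)
    (by linarith : t / 2 < t) hMu) ?_
  · rw [ContinuousLinearMap.comp_apply, ContinuousLinearMap.adjoint_inner_right, heq u]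
    exact norm_inner_le_norm _ _
  · simp only [norm_sqrt_sq, half_rpow_neg ht] at hMr
    push_cast
    linarith

/-- The form of `S` is dominated by that of `V₊`, which is `‖T u‖²` for multiplication by `√V₊`;
hence only the positive part enters. -/
theorem MulOperatorBound.nPlus_le (h : MulOperatorBound N l θ C A μ) (hθ : 0 < θ)
    {V : Eucl N → ℝ} (hV : MemLp V (ENNReal.ofReal θ) μ)
    {S : HomSobolev N l →L[ℂ] HomSobolev N l} (hS : IsFormOperator μ (fun x => (V x : ℂ)) S)
    {t : ℝ} (ht : 0 < t) : (nPlus t S : ℝ≥0∞) ≤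
      ENNReal.ofReal (C * 2 ^ θ * A ^ (θ - 1) * (∫ x, (max (V x) 0) ^ θ ∂μ) * t ^ (-θ)) := by
  have hVm : AEMeasurable V μ := hV.1.aemeasurable
  have hsq : ∀ x, √(max (V x) 0) ^ 2 = max (V x) 0 := fun x => Real.sq_sqrt (le_max_right _ _)
  have hn : ∀ x, ‖((√(max (V x) 0) : ℝ) : ℂ)‖ ^ 2 = max (V x) 0 := fun x => by
    rw [Complex.norm_real, Real.norm_eq_abs, sq_abs, hsq]
  have hi : Integrable (fun x => (max (V x) 0) ^ θ) μ := by
    refine (integrable_rpow_of_memLp hθ hV).mono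
      (AEMeasurable.aestronglyMeasurable (by fun_prop)) (Filter.Eventually.of_forall fun x => ?_)
    have h0 : 0 ≤ max (V x) 0 := le_max_right _ _
    rw [Real.norm_of_nonneg (by positivity), Real.norm_of_nonneg (by positivity)]
    gcongr
    exact max_le (le_abs_self _) (abs_nonneg _)
  obtain ⟨T, hT, hM⟩ := h (fun x => ((√(max (V x) 0) : ℝ) : ℂ))
    (AEMeasurable.aestronglyMeasurable (by fun_prop)) (by simpa only [hn] using hi)
  obtain ⟨M, hMf, hMr, hMu⟩ := hM (t / 2) (by positivity)
  refine natCast_toENNReal_le (nPlus_le_finrank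
    (ContinuousLinearMap.isSelfAdjoint_iff_isSymmetric.1 hS.isSelfAdjoint)
    (hS.re_inner_le hT fun x => (hsq x).symm ▸ le_max_left _ _) (by linarith : t / 2 < t) hMu) ?_
  simp only [hn, half_rpow_neg ht] at hMr
  linarith

end Main

end BirmanSchwinger

end

open BirmanSchwinger in
theorem theorem3p6 (N : ℕ) (l : ℝ≥0) (hl : 0 < l) (hlN : 2 * (l : ℝ) < N)
    (s θ : ℝ) (hs : (N : ℝ) - 2 * l < s) (hθ : θ = s / (2 * l - N + s)) :
    ∃ C : ℝ, 0 < C ∧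
      ∀ (μ : Measure (Eucl N)) (A : ℝ), 0 < A → UpperAhlfors μ s A →
        (∀ X, μ.support ≠ {X}) →
        (∀ V : Eucl N → ℝ, MemLp V (ENNReal.ofReal θ) μ →
          (∃! S : HomSobolev N l →L[ℂ] HomSobolev N l,
            IsFormOperator μ (fun X => (V X : ℂ)) S) ∧
          ∀ S : HomSobolev N l →L[ℂ] HomSobolev N l,
            IsFormOperator μ (fun X => (V X : ℂ)) S →
            IsSelfAdjoint S ∧ IsCompactOperator S ∧
            ∀ t : ℝ, 0 < t →
              (nPlus t S : ℝ≥0∞) ≤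
                ENNReal.ofReal (C * A ^ (θ - 1) * (∫ X, (max (V X) 0) ^ θ ∂μ) * t ^ (-θ)) ∧
              (nMinus t S : ℝ≥0∞) ≤
                ENNReal.ofReal (C * A ^ (θ - 1) * (∫ X, (max (-V X) 0) ^ θ ∂μ) * t ^ (-θ))) ∧
        (∀ V : Eucl N → ℂ, MemLp V (ENNReal.ofReal θ) μ →
          (∃! S : HomSobolev N l →L[ℂ] HomSobolev N l, IsFormOperator μ V S) ∧
          ∀ S : HomSobolev N l →L[ℂ] HomSobolev N l, IsFormOperator μ V S →
            IsCompactOperator S ∧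
            ∀ t : ℝ, 0 < t →
              (nSing t S : ℝ≥0∞) ≤
                ENNReal.ofReal (C * A ^ (θ - 1) * (∫ X, ‖V X‖ ^ θ ∂μ) * t ^ (-θ))) := by
  have hθ' : 0 < θ := by
    rw [hθ]
    exact div_pos (by linarith) (by linarith)
  obtain ⟨C₀, hC₀, hglobal⟩ := exists_globalAhlfors N s (by linarith)
  obtain ⟨C, hC, hmul⟩ := exists_isMulOperator hl hlN hs hθ
  have hC₀' : 0 < C₀ := by linarith
  -- `C₀ ^ (θ - 1)` pays for extending the Ahlfors bound to all radii; the final `2` is needed only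
  -- for singular numbers.
  refine ⟨C * C₀ ^ (θ - 1) * 2 ^ θ * 2, by positivity, fun μ A hA hμ hne => ?_⟩
  have hbound : MulOperatorBound N l θ (C * C₀ ^ (θ - 1)) A μ := fun f hf hfi => by
    obtain ⟨T, hT, hM⟩ := hmul μ (C₀ * A) (by positivity) (hglobal μ A hA hμ hne) f hf hfi
    refine ⟨T, hT, fun ε hε => ?_⟩
    obtain ⟨M, hMf, hMr, hMu⟩ := hM ε hε
    rw [Real.mul_rpow hC₀'.le hA.le, ← mul_assoc] at hMr
    exact ⟨M, hMf, hMr, hMu⟩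
  refine ⟨fun V hV => ?_, fun V hV => ?_⟩
  -- Existence and compactness for real `V` come from the complex case; uniqueness transfers them to
  -- any form operator.
  · obtain ⟨S, hS, hSc, -⟩ := hbound.complex_potential hθ' hV.ofReal
    refine ⟨⟨S, hS, fun S' hS' => hS'.unique hS⟩, fun S' hS' => ?_⟩
    have hle : ∀ {J t : ℝ}, 0 ≤ J → 0 < t →
        C * C₀ ^ (θ - 1) * 2 ^ θ * A ^ (θ - 1) * J * t ^ (-θ) ≤
          C * C₀ ^ (θ - 1) * 2 ^ θ * 2 * A ^ (θ - 1) * J * t ^ (-θ) := by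
      intro J t hJ ht
      have : 0 ≤ C * C₀ ^ (θ - 1) * 2 ^ θ * A ^ (θ - 1) * J * t ^ (-θ) := by positivity
      linarith
    refine ⟨hS'.isSelfAdjoint, hS'.unique hS ▸ hSc, fun t ht => ⟨?_, ?_⟩⟩
    · exact (hbound.nPlus_le hθ' hV hS' ht).trans (ENNReal.ofReal_le_ofReal
        (hle (integral_nonneg fun x => by positivity) ht))
    · have hneg : IsFormOperator μ (fun x => ((-V x : ℝ) : ℂ)) (-S') := by
        simpa only [Complex.ofReal_neg] using hS'.neg
      exact (hbound.nPlus_le hθ' hV.neg hneg ht).trans (ENNReal.ofReal_le_ofReal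
        (hle (integral_nonneg fun x => by positivity) ht))
  · obtain ⟨S, hS, hSc, hn⟩ := hbound.complex_potential hθ' hV
    exact ⟨⟨S, hS, fun S' hS' => hS'.unique hS⟩, fun S' hS' => hS'.unique hS ▸ ⟨hSc, hn⟩⟩
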